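/- For a bounded domain $\Omega\subset\mathbb R^n$ let $\mathring{BV}(\Omega)=\{u\in BV(\Omega):\int_\Omega u\,dx=0\}$. **Proposition.** Let $\Omega\subset\mathbb{R}^n$ be a bounded Lipschitz domain (open, connected, with Lipschitz boundary). There is a constant $C>0$, depending only on $\Omega$, such that the following holds. Let $a:\Omega\to\mathbb{R}$ be a bounded lower semicontinuous function with $a\ge a_0$ on $\Omega$ for some constant $a_0>0$, let $F\in L^1(\Omega;\mathbb{R}^n)$, and let $H\in L^\infty(\Omega)$ satisfy $$\|H\|_{L^\infty(\Omega)}<C\,a_0 .$$ Then the Neumann primal problem $$\inf_{u\in\mathring{BV}(\Omega)} I(u),\qquad I(u)=\int_\Omega a\,|Du+F|+\int_\Omega Hu\,dx,$$ has a minimizer: there is $u\in\mathring{BV}(\Omega)$ with $I(u)\le I(v)$ for all $v\in\mathring{BV}(\Omega)$. Here $Du$ is the $\mathbb{R}^n$-valued distributional gradient measure of $u$, and $|Du+F|$ is the total variation measure of the vector measure $Du+F\,dx$ on $\Omega$. In particular, for $a\equiv1$ the condition reads $\|H\|_{L^\infty(\Omega)}<C$ with $C$ depending only on $\Omega$. 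-/

import Mathlib

open MeasureTheory Set
open scoped ENNReal NNReal ContDiff

noncomputable section

namespace PArea

/-- Euclidean space `ℝⁿ`. -/
abbrev E (n : ℕ) : Type := EuclideanSpace ℝ (Fin n)

/-- `Ω` has Lipschitz boundary: near every boundary point, in a suitable orthonormal frame whose
last vector is `e`, the set `Ω` is the region strictly above the graph of a Lipschitz function of
the remaining coordinates (`y - ⟪e, y⟫ e` is the projection of `y` onto the hyperplane `e^⊥`). -/
def HasLipschitzBoundary {n : ℕ} (Ω : Set (E n)) : Prop :=
  ∀ x₀ ∈ frontier Ω, ∃ (r : ℝ) (e : E n) (K : ℝ≥0) (γ : E n → ℝ),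
    0 < r ∧ ‖e‖ = 1 ∧ LipschitzWith K γ ∧
    Ω ∩ Metric.ball x₀ r =
      {y ∈ Metric.ball x₀ r | γ (y - (inner ℝ e y) • e) < inner ℝ e y}

/-- A bounded Lipschitz domain: bounded, open, connected (and non-empty), with Lipschitz
boundary. -/
structure IsBoundedLipschitzDomain {n : ℕ} (Ω : Set (E n)) : Prop where
  isBounded : Bornology.IsBounded Ω
  isOpen : IsOpen Ω
  isConnected : IsConnected Ω
  lipschitz : HasLipschitzBoundary Ω

/-- The `ℝⁿ`-valued measure `D`, concentrated on the open set `Ω`, is the distributional gradient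
of `u` in `Ω`: `∫_Ω u ∇φ dx = - ∫_Ω φ dD` for all `φ ∈ C_c^∞(Ω)`. -/
structure IsGradMeasure {n : ℕ} (Ω : Set (E n)) (u : E n → ℝ) (D : VectorMeasure (E n) (E n)) :
    Prop where
  restrict_eq : D.restrict Ω = D
  integral_eq : ∀ φ : E n → ℝ, ContDiff ℝ ∞ φ → HasCompactSupport φ → tsupport φ ⊆ Ω →
    ∫ x in Ω, u x • gradient φ x = - ∫ᵛ x, φ x ∂•D

/-- `BV(Ω)`: integrable functions whose distributional gradient is a (finite) vector measure. -/
def BV {n : ℕ} (Ω : Set (E n)) : Set (E n → ℝ) :=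
  {u | IntegrableOn u Ω ∧ ∃ D, IsGradMeasure Ω u D}

/-- The functions of `BV(Ω)` with mean zero. -/
def BVMeanZero {n : ℕ} (Ω : Set (E n)) : Set (E n → ℝ) :=
  {u ∈ BV Ω | ∫ x in Ω, u x = 0}

open Classical in
/-- The gradient measure `Du` of `u ∈ BV(Ω)` (which is unique); `0` if there is none. -/
def gradMeasure {n : ℕ} (Ω : Set (E n)) (u : E n → ℝ) : VectorMeasure (E n) (E n) :=
  if h : ∃ D, IsGradMeasure Ω u D then h.choose else 0

/-- The functional `I(u) = ∫_Ω a |Du + F| + ∫_Ω H u dx`, where `|Du + F|` is the total variation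
measure of the vector measure `Du + F dx` on `Ω`. -/
def energy {n : ℕ} (Ω : Set (E n)) (a : E n → ℝ) (F : E n → E n) (H : E n → ℝ)
    (u : E n → ℝ) : ℝ :=
  (∫ x in Ω, a x ∂(gradMeasure Ω u + (volume.restrict Ω).withDensityᵥ F).variation)
    + ∫ x in Ω, H x * u x

end PArea

end

noncomputable section

namespace PArea

open Filter Topology

/-! The proof is the direct method, with its compactness and semicontinuity ingredients built from
pairings with scalar test functions.

Coercivity. With a Poincaré constant `Cp`, the term in `H` is at least `-‖H‖∞ * Cp * |Du|(Ω)`, while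
the weighted variation is at least `a₀ * (|Du|(Ω) - ∫ ‖F‖)`. For `C = 1 / Cp` the smallness
condition says exactly that `a₀ - ‖H‖∞ * Cp` is positive, so minimizing sequences are bounded in BV
(`le_energy`).

Compactness. A Lipschitz domain admits, near each point of its closure, a cone of translations that
stay inside it (`exists_cone`). Along these the `L¹` modulus of continuity is controlled by the
variation (`lintegral_translate_sub_le`), so a BV function is uniformly close to a step function of
means over small balls shifted into the domain. Finitely many such step functions suffice, which
gives Rellich (`exists_subseq_tendsto`); Poincaré follows by contradiction, since a limit with zero
variation is constant.

Closure. If the gradient measures have bounded mass, a vague limit of their variations dominates the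
weak gradient of the `L¹` limit. The latter is then a bounded functional on `L²` of that finite
measure, hence a measure with density (`exists_isGradMeasure_of_tendsto`).

Lower semicontinuity. The variation of an open set is a supremum over finite families of test
functions. The superlevel sets of `a` are open, so the layer cake formula and Fatou carry this over
to the weight `a` (`setLIntegral_variation_le_liminf`). -/

/-- Test functions on `Ω`: smooth functions whose support is a compact subset of `Ω`. -/
structure IsTest {n : ℕ} (Ω : Set (E n)) (φ : E n → ℝ) : Prop where
  smooth : ContDiff ℝ ∞ φ
  compact : HasCompactSupport φ
  subset : tsupport φ ⊆ Ω

/-! ### Test functions and approximation of indicators -/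

namespace IsTest

variable {n : ℕ} {Ω : Set (E n)} {φ ψ : E n → ℝ}

lemma mono {Ω' : Set (E n)} (h : IsTest Ω φ) (hΩ : Ω ⊆ Ω') : IsTest Ω' φ :=
  ⟨h.smooth, h.compact, h.subset.trans hΩ⟩

lemma continuous (h : IsTest Ω φ) : Continuous φ := h.smooth.continuous

lemma zero : IsTest Ω (0 : E n → ℝ) :=
  ⟨contDiff_const, HasCompactSupport.zero, by simp [tsupport]⟩

lemma add (h : IsTest Ω φ) (h' : IsTest Ω ψ) : IsTest Ω (φ + ψ) :=
  ⟨h.smooth.add h'.smooth, h.compact.add h'.compact,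
    (tsupport_add φ ψ).trans (union_subset h.subset h'.subset)⟩

lemma smul (c : ℝ) (h : IsTest Ω φ) : IsTest Ω (c • φ) :=
  ⟨contDiff_const.smul h.smooth, h.compact.smul_left (f := fun _ => c),
    (closure_mono (Function.support_const_smul_subset c φ)).trans h.subset⟩

lemma sum {ι : Type*} {s : Finset ι} {φ : ι → E n → ℝ} (h : ∀ i ∈ s, IsTest Ω (φ i)) :
    IsTest Ω (∑ i ∈ s, φ i) :=
  Finset.sum_induction φ (IsTest Ω) (fun _ _ => add) zero h

lemma eq_zero_of_notMem (h : IsTest Ω φ) {x : E n} (hx : x ∉ Ω) : φ x = 0 :=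
  image_eq_zero_of_notMem_tsupport fun hx' => hx (h.subset hx')

lemma exists_bound (h : IsTest Ω φ) : ∃ C, 0 ≤ C ∧ ∀ x, ‖φ x‖ ≤ C := by
  obtain ⟨C, hC⟩ := h.compact.exists_bound_of_continuous h.continuous
  exact ⟨C, (norm_nonneg _).trans (hC 0), hC⟩

lemma integrable (h : IsTest Ω φ) (ν : Measure (E n)) [IsFiniteMeasure ν] : Integrable φ ν :=
  h.continuous.integrable_of_hasCompactSupport h.compact

end IsTest

lemma exists_isTest_eq_one {n : ℕ} {K V : Set (E n)} (hK : IsCompact K) (hV : IsOpen V)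
    (hKV : K ⊆ V) : ∃ φ : E n → ℝ, IsTest V φ ∧ (∀ x, φ x ∈ Icc (0 : ℝ) 1) ∧ ∀ x ∈ K, φ x = 1 := by
  obtain ⟨K', hK', hKK', hK'V⟩ := exists_compact_between hK hV hKV
  obtain ⟨f, hf, hfr, hfs, hf1⟩ := exists_contMDiff_support_eq_eq_one_iff
    (modelWithCornersSelf ℝ (E n)) (n := (⊤ : ℕ∞)) isOpen_interior hK.isClosed hKK'
  have hsub : tsupport f ⊆ K' := by
    rw [tsupport, hfs]
    exact closure_minimal interior_subset hK'.isClosed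
  exact ⟨f, ⟨hf.contDiff, hK'.of_isClosed_subset (isClosed_tsupport f) hsub, hsub.trans hK'V⟩,
    fun x => hfr (mem_range_self x), fun x hx => (hf1 x).1 hx⟩

/-- Finitely many disjoint compact sets have disjoint open neighbourhoods. -/
lemma exists_disjoint_open_nhds {X ι : Type*} [TopologicalSpace X] [T2Space X] (s : Finset ι)
    (K : ι → Set X) (hK : ∀ i ∈ s, IsCompact (K i))
    (hd : (s : Set ι).PairwiseDisjoint K) :
    ∃ V : ι → Set X, (∀ i, IsOpen (V i)) ∧ (∀ i ∈ s, K i ⊆ V i) ∧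
      (s : Set ι).PairwiseDisjoint V := by
  classical
  have h : ∀ i j, ∃ A B : Set X, IsOpen A ∧ IsOpen B ∧ (i ∈ s → j ∈ s → i ≠ j →
      K i ⊆ A ∧ K j ⊆ B ∧ Disjoint A B) := by
    intro i j
    by_cases hij : i ∈ s ∧ j ∈ s ∧ i ≠ j
    · obtain ⟨A, B, hA, hB, hiA, hjB, hAB⟩ := SeparatedNhds.of_isCompact_isCompact
        (hK i hij.1) (hK j hij.2.1) (hd hij.1 hij.2.1 hij.2.2)
      exact ⟨A, B, hA, hB, fun _ _ _ => ⟨hiA, hjB, hAB⟩⟩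
    · exact ⟨∅, ∅, isOpen_empty, isOpen_empty, fun hi hj hne => absurd ⟨hi, hj, hne⟩ hij⟩
  choose A B hA hB hAB using h
  -- Each ordered pair was separated independently, so `i` must respect its role as first member of
  -- `(i, j)` and as second member of `(j, i)`.
  refine ⟨fun i => ⋂ j ∈ s.erase i, A i j ∩ B j i, fun i => ?_, fun i hi => ?_, ?_⟩
  · exact isOpen_biInter_finset fun j _ => (hA i j).inter (hB j i)
  · refine subset_iInter₂ fun j hj => ?_
    rw [Finset.mem_erase] at hj
    exact subset_inter (hAB i j hi hj.2 hj.1.symm).1 (hAB j i hj.2 hi hj.1).2.1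
  · intro i hi j hj hij
    refine Disjoint.mono ?_ ?_ (hAB i j hi hj hij).2.2
    · exact (biInter_subset_of_mem (t := fun j => A i j ∩ B j i)
        (Finset.mem_coe.2 (Finset.mem_erase.2 ⟨hij.symm, hj⟩))).trans inter_subset_left
    · exact (biInter_subset_of_mem (t := fun k => A j k ∩ B k j)
        (Finset.mem_coe.2 (Finset.mem_erase.2 ⟨hij, hi⟩))).trans inter_subset_right

/-- The indicators of finitely many disjoint measurable subsets of an open set are approximated
in `L¹` by test functions with sum at most `1`. -/
lemma exists_isTest_approx_indicator {n : ℕ} (ν : Measure (E n)) [IsFiniteMeasure ν]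
    {U : Set (E n)} (hU : IsOpen U) (P : Finset (Set (E n))) (hPU : ∀ t ∈ P, t ⊆ U)
    (hPd : (P : Set (Set (E n))).PairwiseDisjoint id) (hPm : ∀ t ∈ P, MeasurableSet t)
    {ε : ℝ≥0∞} (hε : ε ≠ 0) :
    ∃ φ : Set (E n) → E n → ℝ, (∀ t ∈ P, IsTest U (φ t)) ∧ (∀ t ∈ P, ∀ x, 0 ≤ φ t x) ∧
      (∀ x, ∑ t ∈ P, φ t x ≤ 1) ∧
      ∀ t ∈ P, ∫⁻ x, ‖φ t x - t.indicator 1 x‖ₑ ∂ν ≤ ε := by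
  classical
  have hε2 : ε / 2 ≠ 0 := (ENNReal.half_pos hε).ne'
  have h1 : ∀ t : Set (E n), ∃ K, t ∈ P → K ⊆ t ∧ IsCompact K ∧ ν (t \ K) < ε / 2 := fun t => by
    by_cases ht : t ∈ P
    · obtain ⟨K, hK⟩ := (hPm t ht).exists_isCompact_sdiff_lt (measure_ne_top ν t) hε2
      exact ⟨K, fun _ => hK⟩
    · exact ⟨∅, fun h => absurd h ht⟩
  choose K hK using h1
  -- Cut-offs living in disjoint `V t` never overlap, which keeps their sum at most `1`.
  obtain ⟨V, hVo, hKV, hVd⟩ := exists_disjoint_open_nhds P K (fun t ht => (hK t ht).2.1)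
    (fun s hs t ht hst => (hPd hs ht hst).mono (hK s hs).1 (hK t ht).1)
  have h2 : ∀ t : Set (E n), ∃ φ : E n → ℝ, t ∈ P → IsTest U φ ∧ (∀ x, φ x ∈ Icc (0 : ℝ) 1) ∧
      (∀ x, x ∉ V t → φ x = 0) ∧ ∫⁻ x, ‖φ x - t.indicator 1 x‖ₑ ∂ν ≤ ε := fun t => by
    by_cases ht : t ∈ P
    · obtain ⟨hKt, hKc, hKν⟩ := hK t ht
      obtain ⟨O, hKO, hO, -, hOν⟩ :=
        hKc.measurableSet.exists_isOpen_sdiff_lt (measure_ne_top ν _) hε2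
      obtain ⟨φ, hφ, hφ01, hφ1⟩ := exists_isTest_eq_one hKc ((hO.inter hU).inter (hVo t))
        (subset_inter (subset_inter hKO (hKt.trans (hPU t ht))) (hKV t ht))
      refine ⟨φ, fun _ => ⟨hφ.mono (inter_subset_left.trans inter_subset_right), hφ01,
        fun x hx => hφ.eq_zero_of_notMem fun h => hx h.2, ?_⟩⟩
      -- The cut-off agrees with the indicator on `K t` and outside `t ∪ O`; the error lives on two
      -- sets of measure below `ε / 2`.
      have hb : ∀ x, ‖φ x - t.indicator 1 x‖ₑ ≤
          (t \ K t).indicator 1 x + (O \ K t).indicator 1 x := fun x => by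
        have h01 := hφ01 x
        have hle : ‖φ x - t.indicator 1 x‖ₑ ≤ 1 := by
          rw [← ofReal_norm, ← ENNReal.ofReal_one]
          apply ENNReal.ofReal_le_ofReal
          rw [Real.norm_eq_abs, abs_le]
          by_cases hx : x ∈ t <;> simp [hx] <;> constructor <;> linarith [h01.1, h01.2]
        by_cases hxK : x ∈ K t
        · simp [hφ1 x hxK, hKt hxK]
        · by_cases hxt : x ∈ t
          · exact hle.trans (by simp [hxt, hxK])
          · by_cases hxO : x ∈ O
            · exact hle.trans (by simp [hxO, hxK])
            · simp [hφ.eq_zero_of_notMem fun h => hxO h.1.1, hxt]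
      calc ∫⁻ x, ‖φ x - t.indicator 1 x‖ₑ ∂ν
          ≤ ∫⁻ x, (t \ K t).indicator 1 x + (O \ K t).indicator 1 x ∂ν := lintegral_mono hb
        _ = ν (t \ K t) + ν (O \ K t) := by
            rw [lintegral_add_left (measurable_one.indicator
              ((hPm t ht).diff hKc.measurableSet)),
              lintegral_indicator_one ((hPm t ht).diff hKc.measurableSet),
              lintegral_indicator_one (hO.measurableSet.diff hKc.measurableSet)]
        _ ≤ ε / 2 + ε / 2 := add_le_add hKν.le hOν.le
        _ = ε := ENNReal.add_halves ε
    · exact ⟨0, fun h => absurd h ht⟩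
  choose φ hφ using h2
  refine ⟨φ, fun t ht => (hφ t ht).1, fun t ht x => ((hφ t ht).2.1 x).1, fun x => ?_,
    fun t ht => (hφ t ht).2.2.2⟩
  by_cases hx : ∃ t ∈ P, x ∈ V t
  · obtain ⟨t, ht, hxt⟩ := hx
    rw [Finset.sum_eq_single_of_mem t ht]
    · exact ((hφ t ht).2.1 x).2
    · intro s hs hst
      exact (hφ s hs).2.2.1 x fun hxs => disjoint_left.1 (hVd hs ht hst) hxs hxt
  · push Not at hx
    rw [Finset.sum_eq_zero fun t ht => (hφ t ht).2.2.1 x (hx t ht)]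
    exact zero_le_one

/-! ### Variation of vector measures through test functions -/

variable {n : ℕ}

instance isFiniteMeasure_variation_signed {X : Type*} [MeasurableSpace X] (μ : SignedMeasure X) :
    IsFiniteMeasure (VectorMeasure.variation μ) := by
  rw [← SignedMeasure.totalVariation_eq_variation, SignedMeasure.totalVariation]
  infer_instance

/-- Euclidean vector measures have finite variation. -/
instance isFiniteMeasure_variation (μ : VectorMeasure (E n) (E n)) :
    IsFiniteMeasure μ.variation := by
  -- The coordinates are signed measures, of finite variation by the Jordan decomposition, and the
  -- Euclidean norm is at most the sum of the coordinates' absolute values.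
  let c : Fin n → SignedMeasure (E n) := fun i =>
    μ.mapRange (EuclideanSpace.proj i : E n →L[ℝ] ℝ).toLinearMap.toAddMonoidHom
      (EuclideanSpace.proj i : E n →L[ℝ] ℝ).continuous
  have h : μ.variation ≤ ∑ i, VectorMeasure.variation (c i) := by
    refine VectorMeasure.variation_le_of_forall_enorm_le fun s _ => ?_
    have h1 : ‖μ s‖ₑ ≤ ∑ i, ‖(μ s) i‖ₑ := by
      calc ‖μ s‖ₑ = ‖∑ i, (μ s) i • EuclideanSpace.basisFun (Fin n) ℝ i‖ₑ := by
            conv_lhs => rw [← (EuclideanSpace.basisFun (Fin n) ℝ).sum_repr (μ s)]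
            simp
        _ ≤ ∑ i, ‖(μ s) i • EuclideanSpace.basisFun (Fin n) ℝ i‖ₑ := enorm_sum_le _ _
        _ = ∑ i, ‖(μ s) i‖ₑ := by
            refine Finset.sum_congr rfl fun i _ => ?_
            rw [enorm_smul, ← ofReal_norm (EuclideanSpace.basisFun (Fin n) ℝ i)]
            simp
    refine h1.trans ?_
    rw [Measure.finsetSum_apply]
    refine Finset.sum_le_sum fun i _ => ?_
    exact VectorMeasure.enorm_measure_le_variation (c i) s
  exact isFiniteMeasure_of_le _ h

section

variable {G : Type*} [NormedAddCommGroup G] [NormedSpace ℝ G]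

lemma enorm_integral_le_lintegral_enorm_variation {X : Type*} [MeasurableSpace X]
    (μ : VectorMeasure X G) (f : X → ℝ) :
    ‖∫ᵛ x, f x ∂•μ‖ₑ ≤ ∫⁻ x, ‖f x‖ₑ ∂μ.variation :=
  VectorMeasure.enorm_integral_le_lintegral_enorm_transpose.trans_eq (by rw [VectorMeasure.variation_transpose_lsmul])

lemma integral_indicator_one_vectorMeasure [CompleteSpace G] {X : Type*} [MeasurableSpace X]
    (μ : VectorMeasure X G) [IsFiniteMeasure μ.variation] {s : Set X} (hs : MeasurableSet s) :
    ∫ᵛ x, s.indicator (1 : X → ℝ) x ∂•μ = μ s := by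
  rw [VectorMeasure.integral_indicator hs]
  simp only [Pi.one_apply]
  rw [VectorMeasure.integral_const, VectorMeasure.restrict_apply _ hs MeasurableSet.univ]
  simp

/-- On open sets, the variation is a supremum over finite families of test functions. -/
lemma exists_isTest_lt_sum_of_lt_variation [CompleteSpace G] (μ : VectorMeasure (E n) G)
    [IsFiniteMeasure μ.variation] {U : Set (E n)} (hU : IsOpen U) {c : ℝ≥0∞}
    (hc : c < μ.variation U) :
    ∃ (P : Finset (Set (E n))) (φ : Set (E n) → E n → ℝ), (∀ t ∈ P, IsTest U (φ t)) ∧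
      (∀ t ∈ P, ∀ x, 0 ≤ φ t x) ∧ (∀ x, ∑ t ∈ P, φ t x ≤ 1) ∧
      c < ∑ t ∈ P, ‖∫ᵛ x, φ t x ∂•μ‖ₑ := by
  obtain ⟨P, hPU, hPd, hPm, hcP⟩ := VectorMeasure.exists_lt_sum_of_lt_variation μ hU.measurableSet hc
  obtain ⟨δ, hδ, hδc⟩ : ∃ δ : ℝ≥0∞, δ ≠ 0 ∧ c + δ < ∑ t ∈ P, ‖μ t‖ₑ := by
    obtain ⟨r, hr, hr'⟩ := ENNReal.lt_iff_exists_add_pos_lt.1 hcP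
    exact ⟨r, by simpa using hr.ne', hr'⟩
  -- The slack `δ` is shared among the members of `P`; the `+ 1` covers an empty `P`.
  have hε : δ / (P.card + 1 : ℝ≥0∞) ≠ 0 := by simp [hδ, ENNReal.add_eq_top]
  obtain ⟨φ, hφ, hφ0, hφ1, hφε⟩ :=
    exists_isTest_approx_indicator μ.variation hU P hPU hPd hPm hε
  refine ⟨P, φ, hφ, hφ0, hφ1, ?_⟩
  have key : ∀ t ∈ P, ‖μ t‖ₑ ≤ ‖∫ᵛ x, φ t x ∂•μ‖ₑ + δ / (P.card + 1 : ℝ≥0∞) := fun t ht => by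
    have h1 : ‖(∫ᵛ x, φ t x ∂•μ) - μ t‖ₑ ≤ δ / (P.card + 1 : ℝ≥0∞) := by
      have hi : μ.Integrable (t.indicator (1 : E n → ℝ)) :=
        (integrable_const (1 : ℝ)).indicator (hPm t ht)
      rw [← integral_indicator_one_vectorMeasure μ (hPm t ht),
        ← VectorMeasure.integral_fun_sub ((hφ t ht).integrable _) hi]
      exact (enorm_integral_le_lintegral_enorm_variation _ _).trans (hφε t ht)
    calc ‖μ t‖ₑ = ‖(∫ᵛ x, φ t x ∂•μ) - ((∫ᵛ x, φ t x ∂•μ) - μ t)‖ₑ := by rw [sub_sub_cancel]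
      _ ≤ _ := (enorm_sub_le).trans (add_le_add le_rfl h1)
  have hsum : ∑ t ∈ P, ‖μ t‖ₑ ≤ ∑ t ∈ P, ‖∫ᵛ x, φ t x ∂•μ‖ₑ + δ := by
    refine (Finset.sum_le_sum key).trans ?_
    rw [Finset.sum_add_distrib, Finset.sum_const, nsmul_eq_mul]
    gcongr
    rw [← mul_div_assoc]
    refine ENNReal.div_le_of_le_mul ?_
    rw [mul_comm]
    gcongr
    exact le_self_add
  have hδt : δ ≠ ⊤ := fun h => by simp [h] at hδc
  exact (ENNReal.add_lt_add_iff_right hδt).1 (hδc.trans_le hsum)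

/-- The absolute values of the `φ t` add up to at most the indicator of `U`. With the previous lemma
this makes the variation of `U` a supremum of quantities that are continuous under convergence
against test functions. -/
lemma sum_enorm_integral_le_variation (μ : VectorMeasure (E n) G) {U : Set (E n)} (hU : IsOpen U)
    {P : Finset (Set (E n))} {φ : Set (E n) → E n → ℝ} (hφ : ∀ t ∈ P, IsTest U (φ t))
    (h0 : ∀ t ∈ P, ∀ x, 0 ≤ φ t x) (h1 : ∀ x, ∑ t ∈ P, φ t x ≤ 1) :
    ∑ t ∈ P, ‖∫ᵛ x, φ t x ∂•μ‖ₑ ≤ μ.variation U := by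
  calc ∑ t ∈ P, ‖∫ᵛ x, φ t x ∂•μ‖ₑ ≤ ∑ t ∈ P, ∫⁻ x, ‖φ t x‖ₑ ∂μ.variation :=
        Finset.sum_le_sum fun t _ => enorm_integral_le_lintegral_enorm_variation _ _
    _ = ∫⁻ x, ∑ t ∈ P, ‖φ t x‖ₑ ∂μ.variation :=
        (lintegral_finsetSum' _ fun t ht => (hφ t ht).continuous.enorm.aemeasurable).symm
    _ ≤ ∫⁻ x, U.indicator 1 x ∂μ.variation := by
        refine lintegral_mono fun x => ?_
        by_cases hx : x ∈ U
        · simp only [indicator_of_mem hx, Pi.one_apply]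
          calc ∑ t ∈ P, ‖φ t x‖ₑ = ∑ t ∈ P, ENNReal.ofReal (φ t x) :=
                Finset.sum_congr rfl fun t ht => Real.enorm_eq_ofReal (h0 t ht x)
            _ = ENNReal.ofReal (∑ t ∈ P, φ t x) :=
                (ENNReal.ofReal_sum_of_nonneg fun t ht => h0 t ht x).symm
            _ ≤ 1 := ENNReal.ofReal_le_one.2 (h1 x)
        · rw [Finset.sum_eq_zero fun t ht => by simp [(hφ t ht).eq_zero_of_notMem hx]]
          exact zero_le
    _ = μ.variation U := lintegral_indicator_one hU.measurableSet

/-- Lower semicontinuity of the variation of an open set under convergence against test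
functions. -/
lemma variation_le_liminf_of_tendsto [CompleteSpace G] (μ : VectorMeasure (E n) G)
    [IsFiniteMeasure μ.variation] (μk : ℕ → VectorMeasure (E n) G) {U : Set (E n)} (hU : IsOpen U)
    (h : ∀ φ : E n → ℝ, IsTest U φ →
      Tendsto (fun k => ∫ᵛ x, φ x ∂•(μk k)) atTop (𝓝 (∫ᵛ x, φ x ∂•μ))) :
    μ.variation U ≤ liminf (fun k => (μk k).variation U) atTop := by
  refine le_of_forall_lt fun c hc => ?_
  obtain ⟨c', hcc', hc'⟩ := exists_between hc
  obtain ⟨P, φ, hφ, h0, h1, hlt⟩ := exists_isTest_lt_sum_of_lt_variation μ hU hc'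
  have ht : Tendsto (fun k => ∑ t ∈ P, ‖∫ᵛ x, φ t x ∂•(μk k)‖ₑ) atTop
      (𝓝 (∑ t ∈ P, ‖∫ᵛ x, φ t x ∂•μ‖ₑ)) :=
    tendsto_finsetSum _ fun t ht => (h _ (hφ t ht)).enorm
  refine hcc'.trans_le (le_liminf_of_le (by isBoundedDefault) ?_)
  filter_upwards [ht.eventually_const_lt hlt] with k hk
  exact hk.le.trans (sum_enorm_integral_le_variation (μk k) hU hφ h0 h1)

end

/-- The variation of a signed measure on an open set is tested by single test functions. -/
lemma variation_le_of_forall_isTest (μ : SignedMeasure (E n)) {U : Set (E n)} (hU : IsOpen U)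
    {M : ℝ} (h : ∀ φ : E n → ℝ, IsTest U φ → (∀ x, |φ x| ≤ 1) → ∫ᵛ x, φ x ∂•μ ≤ M) :
    VectorMeasure.variation μ U ≤ ENNReal.ofReal M := by
  refine le_of_forall_lt fun c hc => ?_
  obtain ⟨P, φ, hφ, h0, h1, hlt⟩ := exists_isTest_lt_sum_of_lt_variation μ hU hc
  refine hlt.trans_le ?_
  -- For real pairings, signs merge the whole family into one test function bounded by `1`.
  let s : Set (E n) → ℝ := fun t => SignType.sign (∫ᵛ x, φ t x ∂•μ)
  have hs : ∀ t, |s t| ≤ 1 := fun t => by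
    simp only [s]
    rcases lt_trichotomy (∫ᵛ x, φ t x ∂•μ) 0 with h | h | h <;> simp [h]
  have hM := h (∑ t ∈ P, s t • φ t) (IsTest.sum fun t ht => (hφ t ht).smul _) fun x => by
    simp only [Finset.sum_apply, Pi.smul_apply, smul_eq_mul]
    refine (Finset.abs_sum_le_sum_abs _ _).trans (le_trans (Finset.sum_le_sum fun t ht => ?_) (h1 x))
    rw [abs_mul, abs_of_nonneg (h0 t ht x)]
    exact mul_le_of_le_one_left (h0 t ht x) (hs t)
  have heq : ∫ᵛ x, (∑ t ∈ P, s t • φ t) x ∂•μ = ∑ t ∈ P, |∫ᵛ x, φ t x ∂•μ| := by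
    simp only [Finset.sum_apply]
    rw [VectorMeasure.integral_finsetSum _ fun t ht => ((hφ t ht).smul _).integrable _]
    refine Finset.sum_congr rfl fun t _ => ?_
    simp only [Pi.smul_apply]
    rw [VectorMeasure.integral_fun_smul, smul_eq_mul, sign_mul_self]
  rw [heq] at hM
  calc ∑ t ∈ P, ‖∫ᵛ x, φ t x ∂•μ‖ₑ = ENNReal.ofReal (∑ t ∈ P, |∫ᵛ x, φ t x ∂•μ|) := by
        rw [ENNReal.ofReal_sum_of_nonneg fun t _ => abs_nonneg _]
        exact Finset.sum_congr rfl fun t _ => Real.enorm_eq_ofReal_abs _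
    _ ≤ _ := ENNReal.ofReal_le_ofReal hM

/-- Integration of a bounded function against a vector measure with density. -/
lemma integral_withDensityᵥ_eq {X G : Type*} [MeasurableSpace X] [NormedAddCommGroup G]
    [NormedSpace ℝ G] [CompleteSpace G] {ν : Measure X} {g : X → G} (hg : Integrable g ν)
    {f : X → ℝ} (hf : Measurable f) {C : ℝ} (hC : ∀ x, ‖f x‖ ≤ C) :
    ∫ᵛ x, f x ∂•(ν.withDensityᵥ g) = ∫ x, f x • g x ∂ν := by
  have hfin : IsFiniteMeasure (ν.withDensityᵥ g).variation := by
    rw [Measure.variation_withDensityᵥ hg]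
    exact isFiniteMeasure_withDensity hg.2.ne
  have hsi : ∀ s : SimpleFunc X ℝ, Integrable (fun x => s x • g x) ν := fun s => by
    obtain ⟨B, hB⟩ := s.exists_forall_norm_le
    exact hg.bdd_smul B s.measurable.aestronglyMeasurable (ae_of_all _ hB)
  have hsv : ∀ s : SimpleFunc X ℝ, (ν.withDensityᵥ g).Integrable s := fun s =>
    SimpleFunc.integrable_of_isFiniteMeasure s
  have hs : ∀ s : SimpleFunc X ℝ, ∫ᵛ x, s x ∂•(ν.withDensityᵥ g) = ∫ x, s x • g x ∂ν := by
    intro s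
    induction s using SimpleFunc.induction with
    | const c hs =>
      rename_i s
      have h1 : ⇑(SimpleFunc.piecewise s hs (SimpleFunc.const X c) (SimpleFunc.const X 0)) =
          fun x => c • s.indicator (1 : X → ℝ) x := by
        ext x; by_cases hx : x ∈ s <;> simp [hx]
      rw [h1, VectorMeasure.integral_fun_smul, integral_indicator_one_vectorMeasure _ hs,
        withDensityᵥ_apply hg hs, ← MeasureTheory.integral_indicator hs, ← integral_smul]
      refine integral_congr_ae (ae_of_all _ fun x => ?_)
      by_cases hx : x ∈ s <;> simp [hx]
    | add hd h1 h2 =>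
      simp only [SimpleFunc.coe_add, Pi.add_apply, add_smul]
      rw [VectorMeasure.integral_fun_add (hsv _) (hsv _), integral_add (hsi _) (hsi _), h1, h2]
  -- Both sides agree on simple functions, and dominated convergence applies to each; the
  -- approximants are bounded by `C + C`.
  let F : ℕ → SimpleFunc X ℝ := SimpleFunc.approxOn f hf univ 0 (mem_univ 0)
  have hFt : ∀ x, Tendsto (fun k => F k x) atTop (𝓝 (f x)) := fun x =>
    SimpleFunc.tendsto_approxOn hf (mem_univ 0) (by simp)
  have hFb : ∀ k x, ‖F k x‖ ≤ C + C := fun k x =>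
    (SimpleFunc.norm_approxOn_zero_le hf (mem_univ 0) x k).trans (add_le_add (hC x) (hC x))
  have t1 : Tendsto (fun k => ∫ᵛ x, F k x ∂•(ν.withDensityᵥ g)) atTop
      (𝓝 (∫ᵛ x, f x ∂•(ν.withDensityᵥ g))) :=
    VectorMeasure.tendsto_integral_of_dominated_convergence (fun _ => C + C)
      (fun k => (F k).measurable.aestronglyMeasurable) (integrable_const _)
      (fun k => ae_of_all _ (hFb k)) (ae_of_all _ hFt)
  have t2 : Tendsto (fun k => ∫ x, F k x • g x ∂ν) atTop (𝓝 (∫ x, f x • g x ∂ν)) := by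
    refine tendsto_integral_of_dominated_convergence (fun x => (C + C) * ‖g x‖)
      (fun k => (hsi _).aestronglyMeasurable) (hg.norm.const_mul _)
      (fun k => ae_of_all _ fun x => ?_) (ae_of_all _ fun x => (hFt x).smul_const _)
    rw [norm_smul]
    exact mul_le_mul_of_nonneg_right (hFb k x) (norm_nonneg _)
  simp only [hs] at t1
  exact tendsto_nhds_unique t1 t2

/-- The `L¹` norm on an open set is tested by test functions. -/
lemma lintegral_enorm_le_of_forall_isTest {U : Set (E n)} (hU : IsOpen U) {f : E n → ℝ}
    (hf : IntegrableOn f U) {M : ℝ}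
    (h : ∀ φ : E n → ℝ, IsTest U φ → (∀ x, |φ x| ≤ 1) → ∫ x in U, φ x * f x ≤ M) :
    ∫⁻ x in U, ‖f x‖ₑ ≤ ENNReal.ofReal M := by
  -- The measure with density `f` has variation with density `‖f‖`.
  have h1 := variation_le_of_forall_isTest ((volume.restrict U).withDensityᵥ f) hU (M := M)
    fun φ hφ hφ1 => by
      rw [integral_withDensityᵥ_eq hf hφ.continuous.measurable hφ1]
      exact h φ hφ hφ1
  rwa [Measure.variation_withDensityᵥ hf, withDensity_apply _ hU.measurableSet,
    Measure.restrict_restrict hU.measurableSet, inter_self] at h1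

/-! ### Scalar-tested variation and translations in `L¹` -/

/-- The total variation of `u` in `Ω`, tested by scalar test functions, is at most `M`. -/
def VarLe (Ω : Set (E n)) (u : E n → ℝ) (M : ℝ) : Prop :=
  ∀ φ : E n → ℝ, IsTest Ω φ → (∀ x, |φ x| ≤ 1) → ‖∫ x in Ω, u x • gradient φ x‖ ≤ M

namespace IsTest

variable {Ω : Set (E n)} {φ : E n → ℝ}

lemma continuous_gradient (h : IsTest Ω φ) : Continuous (gradient φ) :=
  (InnerProductSpace.toDual ℝ (E n)).symm.continuous.comp
    (h.smooth.continuous_fderiv (by simp))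

lemma tsupport_gradient_subset (φ : E n → ℝ) : tsupport (gradient φ) ⊆ tsupport φ := by
  refine closure_minimal (fun x hx => ?_) (isClosed_tsupport φ)
  refine support_fderiv_subset ℝ (f := φ) fun h => hx ?_
  simp [gradient, h]

lemma gradient_eq_zero_of_notMem (h : IsTest Ω φ) {x : E n} (hx : x ∉ Ω) :
    gradient φ x = 0 :=
  image_eq_zero_of_notMem_tsupport fun hx' => hx (h.subset (tsupport_gradient_subset φ hx'))

lemma exists_bound_gradient (h : IsTest Ω φ) : ∃ C, 0 ≤ C ∧ ∀ x, ‖gradient φ x‖ ≤ C := by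
  obtain ⟨C, hC⟩ := HasCompactSupport.exists_bound_of_continuous
    (h.compact.of_isClosed_subset (isClosed_tsupport _) (tsupport_gradient_subset φ))
    h.continuous_gradient
  exact ⟨C, (norm_nonneg _).trans (hC 0), hC⟩

lemma inner_gradient (φ : E n → ℝ) (x h : E n) : inner ℝ (gradient φ x) h = fderiv ℝ φ x h := by
  simp [gradient]

lemma integrable_smul_gradient (h : IsTest Ω φ) {u : E n → ℝ} {ν : Measure (E n)}
    (hu : Integrable u ν) : Integrable (fun x => u x • gradient φ x) ν := by
  obtain ⟨C, -, hC⟩ := h.exists_bound_gradient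
  refine Integrable.mono' (hu.norm.mul_const C)
    (hu.aestronglyMeasurable.smul h.continuous_gradient.aestronglyMeasurable)
    (ae_of_all _ fun x => ?_)
  rw [norm_smul]
  exact mul_le_mul_of_nonneg_left (hC x) (norm_nonneg _)

lemma integral_smul_gradient_eq (h : IsTest Ω φ) (u : E n → ℝ) :
    ∫ x in Ω, u x • gradient φ x = ∫ x, u x • gradient φ x :=
  setIntegral_eq_integral_of_forall_compl_eq_zero fun x hx => by
    rw [h.gradient_eq_zero_of_notMem hx, smul_zero]

lemma translate {W : Set (E n)} (h : IsTest W φ) (v : E n) (hv : ∀ x ∈ W, x + v ∈ Ω) :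
    IsTest Ω (fun y => φ (y - v)) := by
  have hsub : ∀ y ∈ tsupport (fun y => φ (y - v)), y - v ∈ tsupport φ := by
    refine closure_minimal (fun y hy => subset_tsupport φ hy)
      ((isClosed_tsupport φ).preimage (continuous_id.sub continuous_const))
  refine ⟨h.smooth.comp (contDiff_id.sub contDiff_const),
    h.compact.comp_homeomorph (Homeomorph.subRight v), fun y hy => ?_⟩
  simpa using hv _ (h.subset (hsub y hy))

end IsTest

lemma gradient_comp_sub (φ : E n → ℝ) (v y : E n) :
    gradient (fun z => φ (z - v)) y = gradient φ (y - v) := by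
  simp only [gradient, fderiv_comp_sub]

/-- Translations of a function of bounded variation, in `L¹`. -/
lemma lintegral_translate_sub_le {Ω W : Set (E n)} (hW : IsOpen W)
    {u : E n → ℝ} (hu : Integrable u) {M : ℝ} (hM : VarLe Ω u M) {h : E n}
    (hseg : ∀ x ∈ W, ∀ t ∈ Icc (0 : ℝ) 1, x + t • h ∈ Ω) :
    ∫⁻ x in W, ‖u (x + h) - u x‖ₑ ≤ ENNReal.ofReal (‖h‖ * M) := by
  have huh : Integrable (fun x => u (x + h)) := hu.comp_add_right h
  refine lintegral_enorm_le_of_forall_isTest hW (huh.sub hu).integrableOn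
    fun φ hφ hφ1 => ?_
  obtain ⟨C, hC0, hC⟩ := hφ.exists_bound_gradient
  have hbu : ∀ {f : E n → ℝ}, Integrable f → ∀ v : E n, Integrable (fun y => φ (y - v) * f y) :=
    fun hf v => hf.bdd_mul (c := 1)
      (hφ.continuous.comp (continuous_id.sub continuous_const)).aestronglyMeasurable
      (ae_of_all _ fun y => hφ1 _)
  -- Moving the translation onto the test function makes `g` differentiable without smoothing `u`.
  -- Its derivative pairs `u` with the gradient of a translated test function, still supported in
  -- `Ω` by `hseg`, so the variation bounds it and the mean value inequality finishes.
  let g : ℝ → ℝ := fun t => ∫ y, φ (y - t • h) * u y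
  have hg : ∀ t : ℝ, HasDerivAt g (∫ y, -(inner ℝ (gradient φ (y - t • h)) h) * u y) t := by
    intro t
    refine (hasDerivAt_integral_of_dominated_loc_of_deriv_le
      (F := fun t y => φ (y - t • h) * u y)
      (F' := fun t y => -(inner ℝ (gradient φ (y - t • h)) h) * u y)
      (bound := fun y => C * ‖h‖ * ‖u y‖) (s := univ) univ_mem
      (Eventually.of_forall fun s => (hbu hu (s • h)).aestronglyMeasurable) (hbu hu (t • h))
      ?_ (ae_of_all _ fun y s _ => ?_) (hu.norm.const_mul _) (ae_of_all _ fun y s _ => ?_)).2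
    · refine Continuous.aestronglyMeasurable ?_ |>.mul hu.aestronglyMeasurable
      exact ((hφ.continuous_gradient.comp (continuous_id.sub continuous_const)).inner
        continuous_const).neg
    · rw [norm_mul, norm_neg]
      refine mul_le_mul_of_nonneg_right ((norm_inner_le_norm _ _).trans ?_) (norm_nonneg _)
      exact mul_le_mul_of_nonneg_right (hC _) (norm_nonneg _)
    · refine HasDerivAt.mul_const ?_ (u y)
      rw [IsTest.inner_gradient, ← map_neg]
      have h1 : HasDerivAt (fun s : ℝ => y - s • h) (-h) s := by
        simpa using ((hasDerivAt_id s).smul_const h).const_sub y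
      exact ((hφ.smooth.differentiable (by simp)) _).hasFDerivAt.comp_hasDerivAt s h1
  have hgb : ∀ t ∈ Ico (0 : ℝ) 1,
      ‖∫ y, -(inner ℝ (gradient φ (y - t • h)) h) * u y‖ ≤ ‖h‖ * M := by
    intro t ht
    have hφt : IsTest Ω (fun y => φ (y - t • h)) :=
      hφ.translate _ fun x hx => hseg x hx t ⟨ht.1, ht.2.le⟩
    have h1 := hM _ hφt fun x => hφ1 _
    rw [hφt.integral_smul_gradient_eq] at h1
    have h2 : ∫ y, -(inner ℝ (gradient φ (y - t • h)) h) * u y =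
        -inner ℝ h (∫ y, u y • gradient (fun z => φ (z - t • h)) y) := by
      rw [← integral_inner (hφt.integrable_smul_gradient hu), ← integral_neg]
      refine integral_congr_ae (ae_of_all _ fun y => ?_)
      simp only [gradient_comp_sub, inner_smul_right, real_inner_comm h]
      ring
    rw [h2, norm_neg]
    exact (norm_inner_le_norm _ _).trans (mul_le_mul_of_nonneg_left h1 (norm_nonneg _))
  have hmv := norm_image_sub_le_of_norm_deriv_le_segment_01'
    (fun t _ => (hg t).hasDerivWithinAt) hgb
  have heq : ∫ x in W, φ x * (u (x + h) - u x) = g 1 - g 0 := by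
    rw [setIntegral_eq_integral_of_forall_compl_eq_zero fun x hx => by
      rw [hφ.eq_zero_of_notMem hx, zero_mul]]
    have e1 : g 1 = ∫ x, φ x * u (x + h) := by
      simp only [g, one_smul]
      rw [← integral_add_right_eq_self _ h]
      simp
    have e0 : g 0 = ∫ x, φ x * u x := by simp [g]
    rw [e1, e0, ← integral_sub]
    · simp [mul_sub]
    · simpa using hbu huh 0
    · simpa using hbu hu 0
  exact heq.trans_le ((Real.le_norm_self _).trans hmv)

/-! ### Interior cones and averages over shifted balls -/

/-- Near every point of the closure of a Lipschitz set, the set is stable under the translations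
in a cone of directions. -/
lemma exists_cone {Ω : Set (E n)} (hΩ : IsOpen Ω) (hL : HasLipschitzBoundary Ω) {x₀ : E n}
    (hx₀ : x₀ ∈ closure Ω) :
    ∃ (ρ c t₀ : ℝ) (w : E n), 0 < ρ ∧ 0 < c ∧ 0 < t₀ ∧ ∀ t : ℝ, 0 < t → t ≤ t₀ →
      ∀ h ∈ Metric.ball (t • w) (c * t), ∀ x ∈ Ω ∩ Metric.ball x₀ ρ, ∀ s ∈ Icc (0 : ℝ) 1,
        x + s • h ∈ Ω := by
  by_cases hx : x₀ ∈ Ω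
  · obtain ⟨R, hR, hRΩ⟩ := Metric.isOpen_iff.1 hΩ x₀ hx
    -- At an interior point every small translation is allowed, so the cone has axis `0`.
    refine ⟨R / 2, 1, R / 2, 0, by positivity, one_pos, by positivity, ?_⟩
    intro t ht0 ht h hh x hx s hs
    apply hRΩ
    have h1 : ‖h‖ < t := by simpa using hh
    have h2 : ‖x - x₀‖ < R / 2 := by simpa [dist_eq_norm] using hx.2
    rw [Metric.mem_ball, dist_eq_norm]
    calc ‖x + s • h - x₀‖ = ‖(x - x₀) + s • h‖ := by congr 1; abel
      _ ≤ ‖x - x₀‖ + s * ‖h‖ := by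
          refine (norm_add_le _ _).trans_eq ?_
          rw [norm_smul, Real.norm_of_nonneg hs.1]
      _ < R := by nlinarith [norm_nonneg h, hs.1, hs.2]
  · obtain ⟨r, e, K, γ, hr, he, hγ, hset⟩ := hL x₀ (by rw [hΩ.frontier_eq]; exact ⟨hx₀, hx⟩)
    have hK : (0 : ℝ) ≤ K := K.2
    -- Write `h = t • e + z` with `‖z‖ ≤ c * t`. Moving by `s • h` gains height at least `s * (t - c
    -- * t)`, while the graph rises by at most `K * s * (2 * c * t)`. The choice `c * (2 * K + 1) =
    -- 1` balances the two, and strictness comes from `x` itself.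
    have hc : 0 < 1 / (2 * (K : ℝ) + 1) := by positivity
    have hc1 : 1 / (2 * (K : ℝ) + 1) ≤ 1 := by
      rw [div_le_one (by positivity)]; linarith
    have hcK : 1 / (2 * (K : ℝ) + 1) * (2 * K + 1) = 1 := by
      field_simp
    set c : ℝ := 1 / (2 * (K : ℝ) + 1)
    refine ⟨r / 2, c, r / 4, e, by positivity, hc, by positivity, ?_⟩
    intro t ht0 ht h hh x hx s hs
    set z : E n := h - t • e with hz
    have hzn : ‖z‖ ≤ c * t := by
      have := Metric.mem_ball.1 hh
      rw [dist_eq_norm] at this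
      exact this.le
    have hhz : h = t • e + z := by rw [hz]; abel
    have hee : inner ℝ e e = (1 : ℝ) := by rw [real_inner_self_eq_norm_sq, he]; norm_num
    have hez : |inner ℝ e z| ≤ ‖z‖ := by
      simpa [he] using abs_real_inner_le_norm e z
    have hhn : ‖h‖ ≤ 2 * t := by
      calc ‖h‖ ≤ ‖t • e‖ + ‖z‖ := by rw [hhz]; exact norm_add_le _ _
        _ ≤ t + c * t := by
          rw [norm_smul, he, mul_one, Real.norm_of_nonneg ht0.le]; linarith
        _ ≤ 2 * t := by nlinarith
    have hxr : ‖x - x₀‖ < r / 2 := by simpa [dist_eq_norm] using hx.2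
    have hyb : x + s • h ∈ Metric.ball x₀ r := by
      rw [Metric.mem_ball, dist_eq_norm]
      calc ‖x + s • h - x₀‖ = ‖(x - x₀) + s • h‖ := by congr 1; abel
        _ ≤ ‖x - x₀‖ + s * ‖h‖ := by
            refine (norm_add_le _ _).trans_eq ?_
            rw [norm_smul, Real.norm_of_nonneg hs.1]
        _ < r := by nlinarith [norm_nonneg h, hs.1, hs.2]
    have hxb : x ∈ {y ∈ Metric.ball x₀ r | γ (y - (inner ℝ e y) • e) < inner ℝ e y} := by
      rw [← hset]
      exact ⟨hx.1, Metric.ball_subset_ball (by linarith) hx.2⟩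
    have hyset : x + s • h ∈ Ω ∩ Metric.ball x₀ r := by
      rw [hset]
      refine ⟨hyb, ?_⟩
      have hin : inner ℝ e (x + s • h) = inner ℝ e x + s * (t + inner ℝ e z) := by
        rw [inner_add_right, inner_smul_right, hhz, inner_add_right, inner_smul_right, hee]
        ring
      have hproj : (x + s • h - (inner ℝ e (x + s • h)) • e) - (x - (inner ℝ e x) • e) =
          s • (z - (inner ℝ e z) • e) := by
        rw [hin, hhz]
        module
      have hpn : ‖z - (inner ℝ e z) • e‖ ≤ 2 * (c * t) := by
        refine (norm_sub_le _ _).trans ?_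
        rw [norm_smul, he, mul_one, Real.norm_eq_abs]
        linarith
      have hlip := hγ.dist_le_mul (x + s • h - (inner ℝ e (x + s • h)) • e)
        (x - (inner ℝ e x) • e)
      rw [Real.dist_eq, dist_eq_norm, hproj, norm_smul, Real.norm_of_nonneg hs.1] at hlip
      have h1 := (le_abs_self _).trans hlip
      have h2 : (K : ℝ) * (s * ‖z - (inner ℝ e z) • e‖) ≤ s * (t - c * t) := by
        calc (K : ℝ) * (s * ‖z - (inner ℝ e z) • e‖) ≤ K * (s * (2 * (c * t))) := by
              have := hs.1
              gcongr
          _ = s * (t * (c * (2 * K + 1)) - c * t) := by ring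
          _ = s * (t - c * t) := by rw [hcK, mul_one]
      have h3 : s * (t - c * t) ≤ s * (t + inner ℝ e z) :=
        mul_le_mul_of_nonneg_left (by linarith [(abs_le.1 hez).1]) hs.1
      have h4 := hxb.2
      exact lt_of_lt_of_eq (by linarith) hin.symm
    exact hyset.1

/-- A bounded measurable set is a finite disjoint union of small measurable sets. -/
lemma exists_finite_partition {W : Set (E n)} (hW : Bornology.IsBounded W)
    (hWm : MeasurableSet W) {r : ℝ} (hr : 0 < r) :
    ∃ (N : ℕ) (A : Fin N → Set (E n)) (p : Fin N → E n), (∀ i, MeasurableSet (A i)) ∧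
      Pairwise (Function.onFun Disjoint A) ∧ (⋃ i, A i) = W ∧ ∀ i, A i ⊆ Metric.ball (p i) r := by
  obtain ⟨s, -, hs, hcov⟩ := hW.isCompact_closure.finite_cover_balls hr
  let q := hs.toFinset.equivFin.symm
  let f : Fin hs.toFinset.card → Set (E n) := fun i => W ∩ Metric.ball (q i : E n) r
  have hf : ∀ i, MeasurableSet (f i) := fun i => hWm.inter measurableSet_ball
  refine ⟨hs.toFinset.card, disjointed f, fun i => q i, fun i => ?_, disjoint_disjointed f, ?_,
    fun i => (disjointed_subset f i).trans inter_subset_right⟩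
  · exact disjointedRec (fun _ j ht => ht.diff (hf j)) (hf i)
  · rw [iUnion_disjointed]
    refine Subset.antisymm (iUnion_subset fun i => inter_subset_left) fun x hx => ?_
    obtain ⟨y, hy, hxy⟩ := mem_iUnion₂.1 (hcov (subset_closure hx))
    refine mem_iUnion.2 ⟨q.symm ⟨y, hs.mem_toFinset.2 hy⟩, hx, ?_⟩
    simpa using hxy

/-- The mean value of `u` on `B`. -/
def meanOn (u : E n → ℝ) (B : Set (E n)) : ℝ :=
  ∫ y, u y ∂((volume B)⁻¹ • volume.restrict B)

lemma abs_meanOn_le {u : E n → ℝ} {B : Set (E n)} (hu : Integrable u) : |meanOn u B| ≤ (volume B)⁻¹.toReal * ∫ y, ‖u y‖ := by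
  rw [meanOn, integral_smul_measure, smul_eq_mul, abs_mul, abs_of_nonneg ENNReal.toReal_nonneg]
  gcongr
  exact (norm_integral_le_integral_norm _).trans
    (setIntegral_le_integral hu.norm (ae_of_all _ fun y => norm_nonneg _))

/-- For `x` within `r` of `p`, the ball of radius `r` about `p + z` lies in the ball of radius `2 *
r` about `x + z`. One mean therefore serves all `x` near `p`, at the cost of doubling the radius of
the set of translations. -/
lemma enorm_sub_meanOn_le {u : E n → ℝ} (hu : Integrable u) {x p z : E n} {r : ℝ} (hr : 0 < r)
    (hx : x ∈ Metric.ball p r) :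
    ‖u x - meanOn u (Metric.ball (p + z) r)‖ₑ ≤ (volume (Metric.ball (0 : E n) r))⁻¹ *
      ∫⁻ h in Metric.ball z (2 * r), ‖u (x + h) - u x‖ₑ := by
  set B := Metric.ball (p + z) r with hB
  have hV : volume B = volume (Metric.ball (0 : E n) r) := Measure.addHaar_ball_center _ _ _
  have hV0 : volume B ≠ 0 := (Metric.measure_ball_pos _ _ hr).ne'
  have hVt : volume B ≠ ⊤ := measure_ball_lt_top.ne
  set ν : Measure (E n) := (volume B)⁻¹ • volume.restrict B with hν
  have hprob : IsProbabilityMeasure ν := ⟨by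
    rw [hν, Measure.smul_apply, Measure.restrict_apply_univ, smul_eq_mul,
      ENNReal.inv_mul_cancel hV0 hVt]⟩
  have huν : Integrable u ν := hu.restrict.smul_measure (ENNReal.inv_ne_top.2 hV0)
  have h1 : u x - meanOn u B = ∫ y, (u x - u y) ∂ν := by
    rw [integral_sub (integrable_const _) huν]
    simp [meanOn, hν]
  rw [h1]
  refine (enorm_integral_le_lintegral_enorm _).trans ?_
  rw [hν, lintegral_smul_measure, hV, smul_eq_mul]
  refine mul_le_mul_right ?_ _
  rw [← lintegral_indicator measurableSet_ball, ← lintegral_indicator measurableSet_ball,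
    ← lintegral_add_left_eq_self _ x]
  refine lintegral_mono fun h => ?_
  by_cases hh : x + h ∈ B
  · have hhz : h ∈ Metric.ball z (2 * r) := by
      rw [Metric.mem_ball, dist_eq_norm] at hh hx ⊢
      calc ‖h - z‖ = ‖(x + h - (p + z)) - (x - p)‖ := by congr 1; abel
        _ ≤ ‖x + h - (p + z)‖ + ‖x - p‖ := norm_sub_le _ _
        _ < 2 * r := by linarith
    rw [indicator_of_mem hh, indicator_of_mem hhz, ← enorm_neg, neg_sub]
  · rw [indicator_of_notMem hh]
    exact zero_le

/-- Approximation in `L¹` of a function by its means over shifted balls. -/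
lemma sum_lintegral_sub_meanOn_le {u : E n → ℝ} (hu : Integrable u) (hum : Measurable u)
    {W : Set (E n)} {z : E n} {r : ℝ} (hr : 0 < r) {K : ℝ≥0∞}
    (hK : ∀ h ∈ Metric.ball z (2 * r), ∫⁻ x in W, ‖u (x + h) - u x‖ₑ ≤ K)
    {N : ℕ} {A : Fin N → Set (E n)} {p : Fin N → E n} (hAm : ∀ i, MeasurableSet (A i))
    (hAd : Pairwise (Function.onFun Disjoint A)) (hAW : (⋃ i, A i) = W)
    (hAp : ∀ i, A i ⊆ Metric.ball (p i) r) :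
    ∑ i, ∫⁻ x in A i, ‖u x - meanOn u (Metric.ball (p i + z) r)‖ₑ ≤
      2 ^ n * K := by
  set V := volume (Metric.ball (0 : E n) r) with hV
  have hV0 : V ≠ 0 := (Metric.measure_ball_pos _ _ hr).ne'
  have hVt : V ≠ ⊤ := measure_ball_lt_top.ne
  have hV2 : volume (Metric.ball z (2 * r)) = 2 ^ n * V := by
    rw [Measure.addHaar_ball_center, Measure.addHaar_ball_mul_of_pos _ _ two_pos, finrank_euclideanSpace,
      Fintype.card_fin, ENNReal.ofReal_pow two_pos.le]
    simp [hV]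
  have hmeas : Measurable (Function.uncurry fun (x h : E n) => ‖u (x + h) - u x‖ₑ) := by
    simp only [Function.uncurry_def]
    fun_prop
  calc ∑ i, ∫⁻ x in A i, ‖u x - meanOn u (Metric.ball (p i + z) r)‖ₑ
      ≤ ∑ i, ∫⁻ x in A i, V⁻¹ * ∫⁻ h in Metric.ball z (2 * r), ‖u (x + h) - u x‖ₑ :=
        Finset.sum_le_sum fun i _ => setLIntegral_mono' (hAm i) fun x hx =>
          enorm_sub_meanOn_le hu hr (hAp i hx)
    _ = ∫⁻ x in W, V⁻¹ * ∫⁻ h in Metric.ball z (2 * r), ‖u (x + h) - u x‖ₑ := by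
        rw [← hAW, lintegral_iUnion hAm hAd, tsum_fintype]
    -- Tonelli puts the average over `h` outside, where `hK` applies; `2 ^ n` is the volume ratio of
    -- the two balls.
    _ = V⁻¹ * ∫⁻ h in Metric.ball z (2 * r), ∫⁻ x in W, ‖u (x + h) - u x‖ₑ := by
        rw [lintegral_const_mul' _ _ (ENNReal.inv_ne_top.2 hV0),
          lintegral_lintegral_swap hmeas.aemeasurable]
    _ ≤ V⁻¹ * ∫⁻ h in Metric.ball z (2 * r), K := by
        gcongr 1
        exact setLIntegral_mono' measurableSet_ball hK
    _ = 2 ^ n * K := by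
        rw [setLIntegral_const, hV2, mul_comm K, ← mul_assoc, mul_comm (2 ^ n), ← mul_assoc,
          ENNReal.inv_mul_cancel hV0 hVt, one_mul]

/-! ### Rellich compactness -/

/-- Measurable functions with `L¹` norm and variation in `Ω` at most `M`. -/
structure BVBounded (Ω : Set (E n)) (M : ℝ) (u : E n → ℝ) : Prop where
  measurable : Measurable u
  integrable : Integrable u
  norm_le : ∫ x, ‖u x‖ ≤ M
  varLe : VarLe Ω u M

/-- The functions of `BVBounded Ω M` are totally bounded in `L¹(Ω ∩ S)`. -/
def TotBddOn (Ω : Set (E n)) (M : ℝ) (S : Set (E n)) : Prop :=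
  ∀ ε : ℝ≥0∞, ε ≠ 0 → ∃ (β : Type) (_ : Finite β) (c : {u // BVBounded Ω M u} → β),
    ∀ u v : {u // BVBounded Ω M u}, c u = c v → ∫⁻ x in Ω ∩ S, ‖u.1 x - v.1 x‖ₑ ≤ ε

lemma TotBddOn.mono {Ω S S' : Set (E n)} {M : ℝ} (h : TotBddOn Ω M S') (hS : S ⊆ S') :
    TotBddOn Ω M S := fun ε hε => by
  obtain ⟨β, hβ, c, hc⟩ := h ε hε
  exact ⟨β, hβ, c, fun u v huv =>
    (lintegral_mono_set (inter_subset_inter_right _ hS)).trans (hc u v huv)⟩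

/-- Pairs of colours, each at precision `ε / 2`, work on the union. This is what lets the local
statement spread over the compact closure of `Ω` by compactness induction. -/
lemma TotBddOn.union {Ω S S' : Set (E n)} {M : ℝ} (h : TotBddOn Ω M S) (h' : TotBddOn Ω M S') :
    TotBddOn Ω M (S ∪ S') := fun ε hε => by
  obtain ⟨β, hβ, c, hc⟩ := h (ε / 2) (ENNReal.half_pos hε).ne'
  obtain ⟨β', hβ', c', hc'⟩ := h' (ε / 2) (ENNReal.half_pos hε).ne'
  refine ⟨β × β', inferInstance, fun u => (c u, c' u), fun u v huv => ?_⟩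
  rw [Prod.mk.injEq] at huv
  rw [inter_union_distrib_left, ← ENNReal.add_halves ε]
  exact (lintegral_union_le _ _ _).trans (add_le_add (hc u v huv.1) (hc' u v huv.2))

/-- Translations in the cone change `u` by at most `(‖w‖ + c) * t * M` in `L¹`, so for small `t`
every `u` is close to the step function of its means over balls shifted by `t • w`. These means form
a bounded vector in a finite-dimensional space, and a finite net there supplies the colours. -/
lemma totBddOn_ball {Ω : Set (E n)} (hΩ : IsOpen Ω) (hb : Bornology.IsBounded Ω) {M : ℝ}
    {x₀ : E n} {ρ c t₀ : ℝ} {w : E n} (hc : 0 < c) (ht₀ : 0 < t₀)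
    (hcone : ∀ t : ℝ, 0 < t → t ≤ t₀ → ∀ h ∈ Metric.ball (t • w) (c * t),
      ∀ x ∈ Ω ∩ Metric.ball x₀ ρ, ∀ s ∈ Icc (0 : ℝ) 1, x + s • h ∈ Ω) :
    TotBddOn Ω M (Metric.ball x₀ ρ) := by
  intro ε hε
  rcases lt_or_ge M 0 with hM | hM
  · refine ⟨Unit, inferInstance, fun _ => (), fun u => ?_⟩
    exact absurd (u.2.norm_le.trans_lt hM) (integral_nonneg fun _ => norm_nonneg _).not_gt
  set W := Ω ∩ Metric.ball x₀ ρ with hWdef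
  have hW : IsOpen W := hΩ.inter Metric.isOpen_ball
  have hWb : Bornology.IsBounded W := hb.subset inter_subset_left
  have hWt : volume W ≠ ⊤ := hWb.measure_lt_top.ne
  -- the scale `t`
  obtain ⟨t, ht0, htt, hte⟩ : ∃ t : ℝ, 0 < t ∧ t ≤ t₀ ∧
      2 ^ n * ENNReal.ofReal ((‖w‖ + c) * t * M) ≤ ε / 3 := by
    have hlim : Tendsto (fun t : ℝ => 2 ^ n * ENNReal.ofReal ((‖w‖ + c) * t * M))
        (𝓝[>] 0) (𝓝 0) := by
      have h1 : Tendsto (fun t : ℝ => ENNReal.ofReal ((‖w‖ + c) * t * M)) (𝓝[>] 0) (𝓝 0) := by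
        have : Tendsto (fun t : ℝ => (‖w‖ + c) * t * M) (𝓝[>] 0) (𝓝 ((‖w‖ + c) * 0 * M)) :=
          (Continuous.tendsto (by fun_prop) 0).mono_left nhdsWithin_le_nhds
        simpa using ENNReal.tendsto_ofReal this
      simpa using ENNReal.Tendsto.const_mul h1 (Or.inr (by simp))
    have hε3 : (0 : ℝ≥0∞) < ε / 3 := ENNReal.div_pos hε (by simp)
    obtain ⟨t, ht1, ht2, ht3⟩ := ((hlim.eventually_le_const hε3).and
      ((Ioc_mem_nhdsGT ht₀) : ∀ᶠ t in 𝓝[>] (0 : ℝ), t ∈ Ioc 0 t₀)).exists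
    exact ⟨t, ht2, ht3, ht1⟩
  -- Averaging doubles the radius, and `2 * r = c * t` is exactly the aperture of the cone.
  set r := c * t / 2 with hr
  have hr0 : 0 < r := by positivity
  have h2r : 2 * r = c * t := by rw [hr]; ring
  obtain ⟨N, A, p, hAm, hAd, hAW, hAp⟩ := exists_finite_partition hWb hW.measurableSet hr0
  let m : (E n → ℝ) → Fin N → ℝ := fun u i => meanOn u (Metric.ball (p i + t • w) r)
  have happrox : ∀ u : {u // BVBounded Ω M u},
      ∑ i, ∫⁻ x in A i, ‖u.1 x - m u.1 i‖ₑ ≤ ε / 3 := fun u => by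
    refine (sum_lintegral_sub_meanOn_le u.2.integrable u.2.measurable (W := W) hr0
      (K := ENNReal.ofReal ((‖w‖ + c) * t * M)) (fun h hh => ?_) hAm hAd hAW hAp).trans hte
    rw [h2r] at hh
    refine (lintegral_translate_sub_le hW u.2.integrable u.2.varLe
      (fun x hx => hcone t ht0 htt h hh x hx)).trans (ENNReal.ofReal_le_ofReal ?_)
    gcongr
    have h1 : ‖h - t • w‖ < c * t := by simpa [dist_eq_norm] using hh
    calc ‖h‖ = ‖t • w + (h - t • w)‖ := by congr 1; abel
      _ ≤ ‖t • w‖ + ‖h - t • w‖ := norm_add_le _ _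
      _ ≤ t * ‖w‖ + c * t := by rw [norm_smul, Real.norm_of_nonneg ht0.le]; linarith
      _ = (‖w‖ + c) * t := by ring
  -- colour by the vector of means
  obtain ⟨η, hη0, hη⟩ : ∃ η : ℝ, 0 < η ∧ ENNReal.ofReal η * volume W ≤ ε / 3 := by
    have hlim : Tendsto (fun η : ℝ => ENNReal.ofReal η * volume W) (𝓝[>] 0) (𝓝 0) := by
      have h1 : Tendsto (fun η : ℝ => ENNReal.ofReal η) (𝓝[>] 0) (𝓝 0) := by
        simpa using (ENNReal.tendsto_ofReal tendsto_id).mono_left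
          (nhdsWithin_le_nhds (a := (0 : ℝ)) (s := Ioi 0))
      simpa using ENNReal.Tendsto.mul_const h1 (Or.inr hWt)
    have hε3 : (0 : ℝ≥0∞) < ε / 3 := ENNReal.div_pos hε (by simp)
    obtain ⟨η, h1, h2⟩ := ((hlim.eventually_le_const hε3).and self_mem_nhdsWithin).exists
    exact ⟨η, h2, h1⟩
  set R : ℝ := (volume (Metric.ball (0 : E n) r))⁻¹.toReal * M
  have hR0 : 0 ≤ R := mul_nonneg ENNReal.toReal_nonneg hM
  have hmR : ∀ u : {u // BVBounded Ω M u}, m u.1 ∈ Metric.closedBall (0 : Fin N → ℝ) R :=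
    fun u => by
      rw [mem_closedBall_zero_iff, pi_norm_le_iff_of_nonneg hR0]
      intro i
      refine (abs_meanOn_le u.2.integrable).trans ?_
      rw [Measure.addHaar_ball_center]
      exact mul_le_mul_of_nonneg_left u.2.norm_le ENNReal.toReal_nonneg
  obtain ⟨T, -, hT, hcov⟩ :=
    (isCompact_closedBall (0 : Fin N → ℝ) R).finite_cover_balls (half_pos hη0)
  have hcol : ∀ u : {u // BVBounded Ω M u}, ∃ a : T, m u.1 ∈ Metric.ball (a : Fin N → ℝ) (η / 2) :=
    fun u => by
      obtain ⟨a, ha, hua⟩ := mem_iUnion₂.1 (hcov (hmR u))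
      exact ⟨⟨a, ha⟩, hua⟩
  choose col hcol using hcol
  have hTf : Finite T := hT
  refine ⟨Fin T.ncard, inferInstance, fun u => Finite.equivFinOfCardEq (n := T.ncard) rfl (col u),
    fun u v huv => ?_⟩
  have huv' : col u = col v := by simpa using huv
  have hmm : ∀ i, ‖m u.1 i - m v.1 i‖ₑ ≤ ENNReal.ofReal η := fun i => by
    rw [← ofReal_norm]
    refine ENNReal.ofReal_le_ofReal ?_
    rw [← dist_eq_norm]
    refine (dist_le_pi_dist _ _ i).trans ?_
    have h1 := Metric.mem_ball.1 (hcol u)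
    have h2 := Metric.mem_ball'.1 (hcol v)
    rw [← huv'] at h2
    linarith [dist_triangle (m u.1) (col u : Fin N → ℝ) (m v.1)]
  have hmeas : ∀ (u : {u // BVBounded Ω M u}) (a : ℝ), Measurable fun x => ‖u.1 x - a‖ₑ :=
    fun u a => (u.2.measurable.sub_const a).enorm
  calc ∫⁻ x in W, ‖u.1 x - v.1 x‖ₑ = ∑ i, ∫⁻ x in A i, ‖u.1 x - v.1 x‖ₑ := by
        rw [← hAW, lintegral_iUnion hAm hAd, tsum_fintype]
    _ ≤ ∑ i, ∫⁻ x in A i, (‖u.1 x - m u.1 i‖ₑ + ‖v.1 x - m v.1 i‖ₑ + ENNReal.ofReal η) := by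
        refine Finset.sum_le_sum fun i _ => lintegral_mono fun x => ?_
        calc ‖u.1 x - v.1 x‖ₑ
            = ‖(u.1 x - m u.1 i) - (v.1 x - m v.1 i) + (m u.1 i - m v.1 i)‖ₑ := by
              congr 1; ring
          _ ≤ _ := (enorm_add_le _ _).trans (add_le_add enorm_sub_le (hmm i))
    _ = (∑ i, ∫⁻ x in A i, ‖u.1 x - m u.1 i‖ₑ) + (∑ i, ∫⁻ x in A i, ‖v.1 x - m v.1 i‖ₑ) +
          ENNReal.ofReal η * volume W := by
        rw [← hAW, measure_iUnion hAd hAm, tsum_fintype, Finset.mul_sum,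
          ← Finset.sum_add_distrib, ← Finset.sum_add_distrib]
        refine Finset.sum_congr rfl fun i _ => ?_
        rw [lintegral_add_right _ measurable_const, lintegral_add_left (hmeas u _),
          setLIntegral_const]
    _ ≤ ε / 3 + ε / 3 + ε / 3 := add_le_add (add_le_add (happrox u) (happrox v)) hη
    _ = ε := ENNReal.add_thirds ε

lemma totBddOn_of_isBoundedLipschitzDomain {Ω : Set (E n)} (hΩ : IsBoundedLipschitzDomain Ω)
    (M : ℝ) : TotBddOn Ω M (closure Ω) := by
  refine hΩ.isBounded.isCompact_closure.induction_on (p := TotBddOn Ω M) ?_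
    (fun _ _ hst ht => ht.mono hst) (fun _ _ hs ht => hs.union ht) fun x hx => ?_
  · exact fun ε _ => ⟨Unit, inferInstance, fun _ => (), fun u v _ => by simp⟩
  · obtain ⟨ρ, c, t₀, w, hρ, hc, ht₀, hcone⟩ := exists_cone hΩ.isOpen hΩ.lipschitz hx
    exact ⟨Metric.ball x ρ, mem_nhdsWithin_of_mem_nhds (Metric.ball_mem_nhds x hρ),
      totBddOn_ball hΩ.isOpen hΩ.isBounded hc ht₀ hcone⟩

/-- Rellich compactness for functions of bounded variation on a bounded Lipschitz domain. -/
theorem exists_subseq_tendsto {Ω : Set (E n)} (hΩ : IsBoundedLipschitzDomain Ω) {M : ℝ}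
    {u : ℕ → E n → ℝ} (hu : ∀ k, BVBounded Ω M (u k)) :
    ∃ (v : E n → ℝ) (k : ℕ → ℕ), Measurable v ∧ Integrable v ∧ (∀ x ∉ Ω, v x = 0) ∧
      StrictMono k ∧ Tendsto (fun j => ∫⁻ x in Ω, ‖u (k j) x - v x‖ₑ) atTop (𝓝 0) := by
  let f : ℕ → (E n →₁[volume.restrict Ω] ℝ) := fun k => (hu k).integrable.restrict.toL1 (u k)
  have hd : ∀ i j, edist (f i) (f j) = ∫⁻ x in Ω, ‖u i x - u j x‖ₑ := fun i j => by
    simp only [f, Integrable.edist_toL1_toL1, ← edist_eq_enorm_sub]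
  have htb : TotallyBounded (range f) := by
    refine Metric.totallyBounded_of_finite_discretization fun ε hε => ?_
    obtain ⟨β, hβ, c, hc⟩ := totBddOn_of_isBoundedLipschitzDomain hΩ M
      (ENNReal.ofReal (ε / 2)) (by simpa using hε)
    have := Fintype.ofFinite β
    choose idx hidx using fun y : range f => y.2
    refine ⟨β, this, fun y => c ⟨u (idx y), hu _⟩, fun y z hyz => ?_⟩
    have h1 := hc _ _ hyz
    rw [inter_eq_left.2 subset_closure, ← hd, hidx, hidx] at h1
    rw [← edist_lt_ofReal]
    exact h1.trans_lt ((ENNReal.ofReal_lt_ofReal_iff hε).2 (half_lt_self hε))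
  have hcpt : IsCompact (closure (range f)) :=
    htb.closure.isCompact_of_isClosed isClosed_closure
  obtain ⟨L, -, k, hk, hkL⟩ := hcpt.tendsto_subseq fun j => subset_closure (mem_range_self j)
  have hLm : Measurable (L : E n → ℝ) := (Lp.stronglyMeasurable L).measurable
  have hΩm : MeasurableSet Ω := hΩ.isOpen.measurableSet
  refine ⟨Ω.indicator L, k, hLm.indicator hΩm, ?_, fun x hx => indicator_of_notMem hx _, hk, ?_⟩
  · exact (integrable_indicator_iff hΩm).2 (L1.integrable_coeFn L)
  · have h1 := tendsto_iff_edist_tendsto_0.1 hkL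
    refine h1.congr fun j => ?_
    rw [Function.comp_apply, L1.edist_def]
    refine lintegral_congr_ae ?_
    filter_upwards [(hu (k j)).integrable.restrict.coeFn_toL1 (μ := volume.restrict Ω),
      ae_restrict_mem hΩm] with x hx hxΩ
    rw [hx, indicator_of_mem hxΩ, edist_eq_enorm_sub]

/-- `L¹` convergence survives a bounded weight. It is used with gradients of test functions, with
the constant `1` for the mean, and with `H`. -/
lemma tendsto_integral_smul_of_tendsto_lintegral {X G : Type*} [MeasurableSpace X]
    [NormedAddCommGroup G] [NormedSpace ℝ G] {μ : Measure X} {u : ℕ → X → ℝ} {v : X → ℝ}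
    {g : X → G} (hu : ∀ j, Integrable (u j) μ) (hv : Integrable v μ)
    (hg : AEStronglyMeasurable g μ) {C : ℝ} (hC : ∀ᵐ x ∂μ, ‖g x‖ ≤ C)
    (h : Tendsto (fun j => ∫⁻ x, ‖u j x - v x‖ₑ ∂μ) atTop (𝓝 0)) :
    Tendsto (fun j => ∫ x, u j x • g x ∂μ) atTop (𝓝 (∫ x, v x • g x ∂μ)) := by
  refine tendsto_integral_of_L1 _ (hv.smul_bdd C hg hC).aestronglyMeasurable
    (Eventually.of_forall fun j => (hu j).smul_bdd C hg hC) ?_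
  have h1 : Tendsto (fun j => ENNReal.ofReal C * ∫⁻ x, ‖u j x - v x‖ₑ ∂μ) atTop (𝓝 0) := by
    simpa using ENNReal.Tendsto.const_mul h (Or.inr ENNReal.ofReal_ne_top)
  refine tendsto_of_tendsto_of_tendsto_of_le_of_le tendsto_const_nhds h1 (fun _ => zero_le)
    fun j => ?_
  beta_reduce
  rw [← lintegral_const_mul' _ _ ENNReal.ofReal_ne_top]
  refine lintegral_mono_ae ?_
  filter_upwards [hC] with x hx
  rw [Pi.smul_apply', ← sub_smul, enorm_smul, mul_comm]
  gcongr
  rw [← ofReal_norm]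
  exact ENNReal.ofReal_le_ofReal hx

lemma VarLe.of_tendsto {Ω : Set (E n)} {u : ℕ → E n → ℝ} {v : E n → ℝ} {M : ℕ → ℝ} {M₀ : ℝ}
    (hu : ∀ j, IntegrableOn (u j) Ω) (hv : IntegrableOn v Ω) (hM : ∀ j, VarLe Ω (u j) (M j))
    (h : Tendsto (fun j => ∫⁻ x in Ω, ‖u j x - v x‖ₑ) atTop (𝓝 0))
    (hM₀ : Tendsto M atTop (𝓝 M₀)) : VarLe Ω v M₀ := fun φ hφ hφ1 => by
  obtain ⟨C, -, hC⟩ := hφ.exists_bound_gradient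
  exact le_of_tendsto_of_tendsto' (tendsto_integral_smul_of_tendsto_lintegral hu hv
    hφ.continuous_gradient.aestronglyMeasurable (ae_of_all _ hC) h).norm hM₀
    fun j => hM j φ hφ hφ1

lemma VarLe.nonneg {Ω : Set (E n)} {u : E n → ℝ} {M : ℝ} (h : VarLe Ω u M) : 0 ≤ M :=
  (norm_nonneg _).trans (h 0 IsTest.zero (by simp))

lemma VarLe.mono {Ω : Set (E n)} {u : E n → ℝ} {M M' : ℝ} (h : VarLe Ω u M) (hM : M ≤ M') :
    VarLe Ω u M' := fun φ hφ hφ1 => (h φ hφ hφ1).trans hM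

lemma VarLe.const_mul {Ω : Set (E n)} {u : E n → ℝ} {M : ℝ} (h : VarLe Ω u M) (c : ℝ) :
    VarLe Ω (fun x => c * u x) (|c| * M) := fun φ hφ hφ1 => by
  simp only [mul_smul]
  rw [integral_smul, norm_smul]
  exact mul_le_mul_of_nonneg_left (h φ hφ hφ1) (abs_nonneg c)

/-! ### Vanishing variation and the Poincaré inequality -/

/-- A function with vanishing weak gradient is locally constant. -/
lemma VarLe.ae_eq_const_ball {Ω : Set (E n)} {u : E n → ℝ} (hu : Integrable u)
    (hum : Measurable u) (h : VarLe Ω u 0) {x₀ : E n} {R : ℝ} (hR : 0 < R)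
    (hb : Metric.ball x₀ R ⊆ Ω) :
    ∃ c : ℝ, volume (Metric.ball x₀ (R / 4) ∩ {x | u x ≠ c}) = 0 := by
  -- Zero variation makes all small translations trivial, so a one-piece partition shows that `u`
  -- equals its mean. Points within `R / 4` moved by less than `R / 2` stay in the ball of radius
  -- `R`.
  have h1 := sum_lintegral_sub_meanOn_le hu hum (W := Metric.ball x₀ (R / 4)) (z := 0)
    (r := R / 4) (K := 0) (by positivity) (fun t ht => ?_) (N := 1)
    (A := fun _ => Metric.ball x₀ (R / 4)) (p := fun _ => x₀) (fun _ => measurableSet_ball)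
    (fun i j hij => absurd (Subsingleton.elim i j) hij) (iUnion_const _) (fun _ => subset_rfl)
  · refine ⟨meanOn u (Metric.ball (x₀ + 0) (R / 4)), ?_⟩
    simp only [Finset.univ_unique, Finset.sum_singleton, mul_zero, nonpos_iff_eq_zero] at h1
    rw [lintegral_eq_zero_iff (hum.sub_const _).enorm] at h1
    have h2 := ae_iff.1 h1
    rw [Measure.restrict_apply' measurableSet_ball, inter_comm] at h2
    simpa [sub_eq_zero] using h2
  · refine (lintegral_translate_sub_le Metric.isOpen_ball hu h fun x hx s hs => hb ?_).trans
      (by simp)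
    rw [mem_ball_zero_iff] at ht
    rw [Metric.mem_ball, dist_eq_norm] at hx ⊢
    calc ‖x + s • t - x₀‖ = ‖(x - x₀) + s • t‖ := by congr 1; abel
      _ ≤ ‖x - x₀‖ + s * ‖t‖ := by
          refine (norm_add_le _ _).trans_eq ?_
          rw [norm_smul, Real.norm_of_nonneg hs.1]
      _ < R := by nlinarith [norm_nonneg t, hs.1, hs.2]

/-- A function with vanishing weak gradient on a connected open set is constant. -/
lemma VarLe.ae_eq_const {Ω : Set (E n)} (hΩ : IsOpen Ω) (hc : IsConnected Ω) {u : E n → ℝ}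
    (hu : Integrable u) (hum : Measurable u) (h : VarLe Ω u 0) :
    ∃ c : ℝ, ∀ᵐ x ∂volume.restrict Ω, u x = c := by
  have h1 : ∀ x, ∃ (r c : ℝ), x ∈ Ω → 0 < r ∧ volume (Metric.ball x r ∩ {x | u x ≠ c}) = 0 := by
    intro x
    by_cases hx : x ∈ Ω
    · obtain ⟨R, hR, hRΩ⟩ := Metric.isOpen_iff.1 hΩ x hx
      obtain ⟨c, hc⟩ := h.ae_eq_const_ball hu hum hR hRΩ
      exact ⟨R / 4, c, fun _ => ⟨by positivity, hc⟩⟩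
    · exact ⟨0, 0, fun h => absurd h hx⟩
  choose r m hrm using h1
  have hm : ∀ x ∈ Ω, ∀ y ∈ Ω, m x = m y := by
    intro x hx y hy
    refine hc.isPreconnected.induction₂ (fun x y => m x = m y) (fun x hx => ?_)
      (fun _ _ _ _ _ _ => Eq.trans) (fun _ _ _ _ => Eq.symm) hx hy
    filter_upwards [self_mem_nhdsWithin,
      mem_nhdsWithin_of_mem_nhds (Metric.ball_mem_nhds x (hrm x hx).1)] with y hy hyx
    by_contra hne
    -- Two overlapping balls meet in an open set of positive measure, on which `u` cannot equal two
    -- different constants almost everywhere.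
    have hopen : IsOpen (Metric.ball x (r x) ∩ Metric.ball y (r y)) :=
      Metric.isOpen_ball.inter Metric.isOpen_ball
    refine (hopen.measure_pos volume ⟨y, hyx, Metric.mem_ball_self (hrm y hy).1⟩).ne' ?_
    refine measure_mono_null (fun z hz => ?_)
      (measure_union_null (hrm x hx).2 (hrm y hy).2)
    by_cases hz' : u z = m x
    · exact Or.inr ⟨hz.2, fun h => hne (hz'.symm.trans h)⟩
    · exact Or.inl ⟨hz.1, hz'⟩
  obtain ⟨x₀, hx₀⟩ := hc.nonempty
  refine ⟨m x₀, ?_⟩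
  rw [ae_iff, Measure.restrict_apply' hΩ.measurableSet]
  refine measure_null_of_locally_null _ fun x hx => ⟨_, inter_mem_nhdsWithin _
    (Metric.ball_mem_nhds x (hrm x hx.2).1), measure_mono_null (fun z hz => ?_) (hrm x hx.2).2⟩
  exact ⟨hz.2, fun h => hz.1.1 (h.trans (hm x hx.2 x₀ hx₀))⟩

/-- The Poincaré inequality on a bounded Lipschitz domain. -/
theorem exists_poincare_const {Ω : Set (E n)} (hΩ : IsBoundedLipschitzDomain Ω) :
    ∃ C : ℝ, 0 < C ∧ ∀ (u : E n → ℝ) (M : ℝ), Measurable u → Integrable u → (∀ x ∉ Ω, u x = 0) →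
      ∫ x, u x = 0 → VarLe Ω u M → ∫ x, ‖u x‖ ≤ C * M := by
  by_contra! hcon
  -- Normalised to `L¹` norm `1`, these counterexamples have variation at most `1 / (k + 1)`. A
  -- subsequential limit has zero variation, hence is constant, hence zero by its mean, against norm
  -- `1`.
  choose! u M hum hui hu0 humean huM hgt using fun k : ℕ => hcon (k + 1) (by positivity)
  have hM0 : ∀ k, 0 ≤ M k := fun k => (huM k).nonneg
  have hpos : ∀ k, 0 < ∫ x, ‖u k x‖ := fun k =>
    (mul_nonneg (by positivity) (hM0 k)).trans_lt (hgt k)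
  let a : ℕ → ℝ := fun k => (∫ x, ‖u k x‖)⁻¹
  have ha : ∀ k, 0 < a k := fun k => inv_pos.2 (hpos k)
  let v : ℕ → E n → ℝ := fun k x => a k * u k x
  have hvi : ∀ k, Integrable (v k) := fun k => (hui k).const_mul _
  have hvn : ∀ k, ∫ x, ‖v k x‖ = 1 := fun k => by
    simp only [v, norm_mul, Real.norm_of_nonneg (ha k).le]
    rw [integral_const_mul]
    exact inv_mul_cancel₀ (hpos k).ne'
  have hvV : ∀ k, VarLe Ω (v k) (1 / ((k : ℝ) + 1)) := fun k => by
    refine ((huM k).const_mul (a k)).mono ?_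
    rw [abs_of_pos (ha k), le_div_iff₀ (by positivity), mul_assoc]
    calc a k * (M k * (k + 1)) ≤ a k * ∫ x, ‖u k x‖ := by
          refine mul_le_mul_of_nonneg_left ?_ (ha k).le
          rw [mul_comm]; exact (hgt k).le
      _ = 1 := inv_mul_cancel₀ (hpos k).ne'
  obtain ⟨w, k, hwm, hwi, hw0, hk, hlim⟩ := exists_subseq_tendsto hΩ (M := 1) (u := v) fun k =>
    ⟨(hum k).const_mul _, hvi k, (hvn k).le, (hvV k).mono (by
      rw [div_le_one (by positivity)]; linarith [(Nat.cast_nonneg k : (0 : ℝ) ≤ k)])⟩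
  have hset : ∀ f : E n → ℝ, (∀ x ∉ Ω, f x = 0) → ∫ x in Ω, f x = ∫ x, f x := fun f hf =>
    setIntegral_eq_integral_of_forall_compl_eq_zero hf
  have hv0 : ∀ k, ∀ x ∉ Ω, v k x = 0 := fun k x hx => by simp [v, hu0 k x hx]
  have hw : VarLe Ω w 0 := VarLe.of_tendsto (fun j => (hvi (k j)).integrableOn) hwi.integrableOn
    (fun j => hvV (k j)) hlim (tendsto_one_div_add_atTop_nhds_zero_nat.comp hk.tendsto_atTop)
  obtain ⟨c, hc⟩ := hw.ae_eq_const hΩ.isOpen hΩ.isConnected hwi hwm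
  have hmean : ∫ x in Ω, w x = 0 := by
    have h1 := tendsto_integral_smul_of_tendsto_lintegral (μ := volume.restrict Ω)
      (g := fun _ => (1 : ℝ)) (C := 1) (fun j => (hvi (k j)).restrict) hwi.restrict
      aestronglyMeasurable_const (by simp) hlim
    simp only [smul_eq_mul, mul_one] at h1
    refine tendsto_nhds_unique h1 (tendsto_const_nhds.congr fun j => ?_)
    rw [hset _ (hv0 _)]
    simp only [v]
    rw [integral_const_mul, humean, mul_zero]
  have hnorm : ∫ x in Ω, ‖w x‖ = 1 := by
    have h1 : Tendsto (fun j => ∫ x in Ω, ‖v (k j) x‖) atTop (𝓝 (∫ x in Ω, ‖w x‖)) := by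
      refine tendsto_integral_of_L1 _ hwi.norm.restrict.aestronglyMeasurable
        (Eventually.of_forall fun j => (hvi (k j)).norm.restrict) ?_
      refine tendsto_of_tendsto_of_tendsto_of_le_of_le tendsto_const_nhds hlim
        (fun _ => zero_le) fun j => lintegral_mono fun x => ?_
      rw [← ofReal_norm, ← ofReal_norm]
      exact ENNReal.ofReal_le_ofReal (abs_norm_sub_norm_le _ _)
    refine tendsto_nhds_unique h1 (tendsto_const_nhds.congr fun j => ?_)
    rw [setIntegral_eq_integral_of_forall_compl_eq_zero fun x hx => by
      rw [hv0 _ x hx, norm_zero], hvn]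
  have hvol : 0 < volume.real Ω := ENNReal.toReal_pos
    (hΩ.isOpen.measure_pos volume hΩ.isConnected.nonempty).ne' hΩ.isBounded.measure_lt_top.ne
  have hc0 : c = 0 := by
    rw [integral_congr_ae hc, integral_const] at hmean
    simpa [hvol.ne'] using hmean
  rw [integral_congr_ae (hc.mono fun x hx => by rw [hx, hc0, norm_zero])] at hnorm
  simp at hnorm

/-! ### Closure of BV: vague limits and representation of the gradient -/

/-- A sequence of finite measures with bounded mass has a vague limit along an ultrafilter. -/
lemma exists_vague_limit (μ : ℕ → Measure (E n)) [∀ k, IsFiniteMeasure (μ k)] {M : ℝ}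
    (hM : ∀ k, (μ k).real univ ≤ M) :
    ∃ ν : Measure (E n), IsFiniteMeasure ν ∧ ∀ f : E n → ℝ, Continuous f → HasCompactSupport f →
      Tendsto (fun k => ∫ x, f x ∂(μ k)) (hyperfilter ℕ) (𝓝 (∫ x, f x ∂ν)) := by
  have hint : ∀ (f : CompactlySupportedContinuousMap (E n) ℝ) k, Integrable f (μ k) :=
    fun f k => f.continuous.integrable_of_hasCompactSupport f.hasCompactSupport
  -- Along an ultrafilter every bounded real sequence converges, so the limit exists for all `f` at
  -- once, with no diagonal extraction, and inherits linearity and positivity.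
  have hex : ∀ f : CompactlySupportedContinuousMap (E n) ℝ,
      ∃ l, Tendsto (fun k => ∫ x, f x ∂(μ k)) (hyperfilter ℕ) (𝓝 l) := fun f => by
    obtain ⟨C, hC⟩ := f.hasCompactSupport.exists_bound_of_continuous f.continuous
    have hC0 : 0 ≤ C := (norm_nonneg _).trans (hC 0)
    have hb : ∀ k, ∫ x, f x ∂(μ k) ∈ Metric.closedBall (0 : ℝ) (C * M) := fun k => by
      rw [mem_closedBall_zero_iff]
      exact (norm_integral_le_of_norm_le_const (ae_of_all _ hC)).trans
        (mul_le_mul_of_nonneg_left (hM k) hC0)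
    obtain ⟨l, -, hl⟩ := (isCompact_closedBall (0 : ℝ) (C * M)).ultrafilter_le_nhds'
      ((hyperfilter ℕ).map fun k => ∫ x, f x ∂(μ k)) (Ultrafilter.mem_map.2 (Filter.univ_mem' hb))
    exact ⟨l, hl⟩
  choose Λ hΛ using hex
  let Λl : CompactlySupportedContinuousMap (E n) ℝ →ₗ[ℝ] ℝ :=
    { toFun := Λ
      map_add' := fun f g => tendsto_nhds_unique (hΛ (f + g)) <|
        ((hΛ f).add (hΛ g)).congr fun k => (integral_add (hint f k) (hint g k)).symm
      map_smul' := fun c f => tendsto_nhds_unique (hΛ (c • f)) <|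
        ((hΛ f).const_smul c).congr fun k => (integral_smul c _).symm }
  let Λp := PositiveLinearMap.mk₀ Λl fun f hf =>
    ge_of_tendsto' (hΛ f) fun k => integral_nonneg (show (0 : E n → ℝ) ≤ ⇑f from hf)
  have hcpt : ∀ K : Set (E n), IsCompact K → RealRMK.rieszMeasure Λp K ≤ ENNReal.ofReal M := by
    intro K hK
    obtain ⟨φ, hφ, hφ01, hφ1⟩ := exists_isTest_eq_one hK isOpen_univ (subset_univ K)
    let f : CompactlySupportedContinuousMap (E n) ℝ := ⟨⟨φ, hφ.continuous⟩, hφ.compact⟩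
    refine (RealRMK.rieszMeasure_le_of_eq_one Λp (f := f) (fun x => (hφ01 x).1) hK hφ1).trans
      (ENNReal.ofReal_le_ofReal ?_)
    refine le_of_tendsto' (hΛ f) fun k => ?_
    calc ∫ x, φ x ∂(μ k) ≤ ∫ x, (1 : ℝ) ∂(μ k) :=
          integral_mono (hφ.integrable _) (integrable_const _) fun x => (hφ01 x).2
      _ = (μ k).real univ := by simp
      _ ≤ M := hM k
  refine ⟨RealRMK.rieszMeasure Λp, ⟨?_⟩, fun f hf hfc => ?_⟩
  · have hmono : Monotone fun k : ℕ => Metric.closedBall (0 : E n) k := fun i j hij =>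
      Metric.closedBall_subset_closedBall (by exact_mod_cast hij)
    rw [← Metric.iUnion_closedBall_nat (0 : E n), hmono.measure_iUnion]
    exact (iSup_le fun k => hcpt _ (isCompact_closedBall _ _)).trans_lt ENNReal.ofReal_lt_top
  · have h1 := RealRMK.integral_rieszMeasure Λp ⟨⟨f, hf⟩, hfc⟩
    have h2 := hΛ ⟨⟨f, hf⟩, hfc⟩
    have h3 : ∫ x, f x ∂(RealRMK.rieszMeasure Λp) = Λ ⟨⟨f, hf⟩, hfc⟩ := h1
    rw [h3]
    exact h2

/-- A functional dominated by the norm of a linear image in a Hilbert space is an inner product. -/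
lemma exists_inner_eq_of_le {V H : Type*} [AddCommGroup V] [Module ℝ V] [NormedAddCommGroup H]
    [InnerProductSpace ℝ H] [CompleteSpace H] (T : V →ₗ[ℝ] H) (l : V →ₗ[ℝ] ℝ) (C : ℝ)
    (h : ∀ v, ‖l v‖ ≤ C * ‖T v‖) : ∃ g : H, ∀ v, l v = inner ℝ g (T v) := by
  -- The bound makes `l` vanish on the kernel of `T`, so `l` descends to the range of `T`;
  -- Hahn–Banach extends it to `H` and Riesz represents it.
  obtain ⟨s, hs⟩ := LinearMap.exists_rightInverse_of_surjective T.rangeRestrict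
    T.range_rangeRestrict
  have hs' : ∀ w : LinearMap.range T, T (s w) = w := fun w =>
    congrArg Subtype.val (LinearMap.congr_fun hs w)
  let f : StrongDual ℝ (LinearMap.range T) := (l.comp s).mkContinuous C fun w => by
    simpa [hs'] using h (s w)
  obtain ⟨F, hF, -⟩ := exists_extension_norm_eq _ f
  refine ⟨(InnerProductSpace.toDual ℝ H).symm F, fun v => ?_⟩
  rw [InnerProductSpace.toDual_symm_apply]
  have h1 : F (T v) = l (s (T.rangeRestrict v)) := hF (T.rangeRestrict v)
  have h2 := h (s (T.rangeRestrict v) - v)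
  have h3 : (T.rangeRestrict v : H) = T v := rfl
  rw [map_sub T, hs', h3, sub_self, norm_zero, mul_zero, map_sub] at h2
  rw [h1, eq_comm, ← sub_eq_zero, ← norm_le_zero_iff]
  exact h2

/-- The space of test functions. -/
def testSubmodule (Ω : Set (E n)) : Submodule ℝ (E n → ℝ) where
  carrier := {φ | IsTest Ω φ}
  add_mem' := IsTest.add
  zero_mem' := IsTest.zero
  smul_mem' c _ h := h.smul c

lemma IsTest.gradient_add {Ω : Set (E n)} {φ ψ : E n → ℝ} (h : IsTest Ω φ) (h' : IsTest Ω ψ)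
    (x : E n) : gradient (φ + ψ) x = gradient φ x + gradient ψ x := by
  simp only [gradient]
  rw [fderiv_add ((h.smooth.differentiable (by simp)) x)
    ((h'.smooth.differentiable (by simp)) x), map_add]

lemma IsTest.gradient_smul {Ω : Set (E n)} {φ : E n → ℝ} (h : IsTest Ω φ) (c : ℝ)
    (x : E n) : gradient (c • φ) x = c • gradient φ x := by
  simp only [gradient]
  rw [fderiv_const_smul ((h.smooth.differentiable (by simp)) x), map_smulₛₗ]
  simp

/-- If the weak gradient is dominated by a finite measure, then it is a vector measure. -/
lemma exists_isGradMeasure_of_le {Ω : Set (E n)} (hΩ : IsOpen Ω) {u : E n → ℝ}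
    (hu : IntegrableOn u Ω) (ν : Measure (E n)) [IsFiniteMeasure ν]
    (h : ∀ φ, IsTest Ω φ → ‖∫ x in Ω, u x • gradient φ x‖ ≤ ∫ x, |φ x| ∂ν) :
    ∃ D, IsGradMeasure Ω u D := by
  -- Nothing is lost in the bound, since test functions vanish off `Ω`, and the measure built from
  -- `ν'` is concentrated on `Ω`.
  set ν' := ν.restrict Ω with hν'
  have hmem : ∀ φ : testSubmodule Ω, MemLp φ.1 2 ν' := fun φ => by
    obtain ⟨C, -, hC⟩ := φ.2.exists_bound
    exact MemLp.of_bound φ.2.continuous.aestronglyMeasurable C (ae_of_all _ hC)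
  let T : testSubmodule Ω →ₗ[ℝ] Lp ℝ 2 ν' :=
    { toFun := fun φ => (hmem φ).toLp φ.1
      map_add' := fun φ ψ => MemLp.toLp_add (hmem φ) (hmem ψ)
      map_smul' := fun c φ => MemLp.toLp_const_smul c (hmem φ) }
  let L : testSubmodule Ω →ₗ[ℝ] E n :=
    { toFun := fun φ => -∫ x in Ω, u x • gradient φ.1 x
      map_add' := fun φ ψ => by
        rw [← neg_add, ← integral_add (φ.2.integrable_smul_gradient hu)
          (ψ.2.integrable_smul_gradient hu)]
        simp only [Submodule.coe_add, φ.2.gradient_add ψ.2, smul_add]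
      map_smul' := fun c φ => by
        simp only [Submodule.coe_smul, φ.2.gradient_smul, smul_comm _ c, integral_smul, smul_neg,
          RingHom.id_apply] }
  -- The Hölder constant of `L² ⊆ L¹`, the square root of the mass of `ν'`: it turns the `L¹`
  -- domination into an `L²` bound, so that Hilbert space duality suffices.
  set C : ℝ := (ν' univ ^ (1 / (1 : ℝ≥0∞).toReal - 1 / (2 : ℝ≥0∞).toReal)).toReal with hC
  have hL : ∀ φ, ‖L φ‖ ≤ C * ‖T φ‖ := fun φ => by
    have h1 : ‖L φ‖ ≤ ∫ x, ‖φ.1 x‖ ∂ν' := by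
      change ‖-_‖ ≤ _
      have h0 : ∫ x, ‖φ.1 x‖ ∂ν' = ∫ x, |φ.1 x| ∂ν :=
        setIntegral_eq_integral_of_forall_compl_eq_zero fun x hx => by
          rw [φ.2.eq_zero_of_notMem hx, norm_zero]
      rw [norm_neg, h0]
      exact h φ.1 φ.2
    refine h1.trans ?_
    have hm := φ.2.continuous.aestronglyMeasurable (μ := ν')
    have h2 := eLpNorm_le_eLpNorm_mul_rpow_measure_univ (p := 1) (q := 2) one_le_two hm
    rw [integral_norm_eq_lintegral_enorm hm, ← eLpNorm_one_eq_lintegral_enorm, mul_comm]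
    change _ ≤ ‖(hmem φ).toLp φ.1‖ * _
    rw [Lp.norm_toLp, hC, ← ENNReal.toReal_mul]
    refine ENNReal.toReal_mono (ENNReal.mul_ne_top (hmem φ).2.ne ?_) h2
    exact ENNReal.rpow_ne_top_of_nonneg (by norm_num) (measure_ne_top _ _)
  have hg : ∀ i : Fin n, ∃ g : Lp ℝ 2 ν', ∀ φ, (L φ) i = inner ℝ g (T φ) := fun i =>
    exists_inner_eq_of_le T ((EuclideanSpace.proj i : E n →L[ℝ] ℝ).toLinearMap.comp L) C
      fun φ => (PiLp.norm_apply_le _ i).trans (hL φ)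
  choose g hg using hg
  have hgi : ∀ i, Integrable (g i) ν' := fun i => (Lp.memLp (g i)).integrable one_le_two
  let G : E n → E n := fun x => ∑ i, g i x • EuclideanSpace.basisFun (Fin n) ℝ i
  have hG : Integrable G ν' := integrable_finsetSum _ fun i _ => (hgi i).smul_const _
  refine ⟨ν'.withDensityᵥ G, ?_, fun φ hφ hφc hφΩ => ?_⟩
  · ext1 s hs
    rw [VectorMeasure.restrict_apply _ hΩ.measurableSet hs,
      withDensityᵥ_apply hG (hs.inter hΩ.measurableSet), withDensityᵥ_apply hG hs, hν',
      Measure.restrict_restrict (hs.inter hΩ.measurableSet), Measure.restrict_restrict hs,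
      inter_assoc, inter_self]
  · have hφt : IsTest Ω φ := ⟨hφ, hφc, hφΩ⟩
    obtain ⟨B, -, hB⟩ := hφt.exists_bound
    rw [integral_withDensityᵥ_eq hG hφt.continuous.measurable hB]
    obtain ⟨ψ, hψ⟩ : ∃ ψ : testSubmodule Ω, ψ.1 = φ := ⟨⟨φ, hφt⟩, rfl⟩
    have hLφ : ∫ x in Ω, u x • gradient φ x = -L ψ := by
      rw [← hψ]
      exact (neg_neg _).symm
    have hint : ∀ i, Integrable (fun x => (φ x * g i x) • EuclideanSpace.basisFun (Fin n) ℝ i) ν' :=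
      fun i => ((hgi i).bdd_mul hφt.continuous.aestronglyMeasurable
        (ae_of_all _ hB)).smul_const _
    rw [hLφ, neg_inj, ← (EuclideanSpace.basisFun (Fin n) ℝ).sum_repr (L ψ)]
    simp only [G, Finset.smul_sum, smul_smul]
    rw [integral_finsetSum _ fun i _ => hint i]
    refine Finset.sum_congr rfl fun i _ => ?_
    rw [integral_smul_const, EuclideanSpace.basisFun_repr, hg i ψ, L2.inner_def]
    congr 1
    refine integral_congr_ae ?_
    filter_upwards [(hmem ψ).coeFn_toLp] with x hx
    change inner ℝ (g i x) ((hmem ψ).toLp ψ.1 x) = _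
    rw [hx, hψ]
    simp

lemma norm_integral_le_integral_abs_variation (D : VectorMeasure (E n) (E n)) (f : E n → ℝ) :
    ‖∫ᵛ x, f x ∂•D‖ ≤ ∫ x, |f x| ∂D.variation :=
  VectorMeasure.norm_integral_le_integral_norm.trans
    (mul_le_of_le_one_left (integral_nonneg fun _ => norm_nonneg _)
      ContinuousLinearMap.opNorm_lsmul_le)

lemma IsGradMeasure.varLe {Ω : Set (E n)} {u : E n → ℝ} {D : VectorMeasure (E n) (E n)}
    (h : IsGradMeasure Ω u D) : VarLe Ω u (D.variation.real univ) := fun φ hφ hφ1 => by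
  rw [h.integral_eq φ hφ.smooth hφ.compact hφ.subset, norm_neg]
  refine (norm_integral_le_integral_abs_variation D φ).trans ?_
  calc ∫ x, |φ x| ∂D.variation ≤ ∫ _, (1 : ℝ) ∂D.variation :=
        integral_mono (hφ.integrable _).abs (integrable_const _) hφ1
    _ = D.variation.real univ := by simp

/-- `BV` is closed under `L¹` convergence with bounded variation. -/
theorem exists_isGradMeasure_of_tendsto {Ω : Set (E n)} (hΩ : IsOpen Ω) {u : ℕ → E n → ℝ}
    {v : E n → ℝ} (hu : ∀ k, IntegrableOn (u k) Ω) (hv : IntegrableOn v Ω)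
    {D : ℕ → VectorMeasure (E n) (E n)} (hD : ∀ k, IsGradMeasure Ω (u k) (D k)) {M : ℝ}
    (hM : ∀ k, (D k).variation.real univ ≤ M)
    (h : Tendsto (fun k => ∫⁻ x in Ω, ‖u k x - v x‖ₑ) atTop (𝓝 0)) :
    ∃ D, IsGradMeasure Ω v D := by
  obtain ⟨ν, hν, hlim⟩ := exists_vague_limit (fun k => (D k).variation) hM
  refine exists_isGradMeasure_of_le hΩ hv ν fun φ hφ => ?_
  obtain ⟨C, -, hC⟩ := hφ.exists_bound_gradient
  have h1 := (tendsto_integral_smul_of_tendsto_lintegral hu hv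
    hφ.continuous_gradient.aestronglyMeasurable (ae_of_all _ hC) h).norm
  -- The vague limit exists only along the hyperfilter, which is finer than `atTop`, so the `L¹`
  -- limits are restricted to it.
  refine le_of_tendsto_of_tendsto' (h1.mono_left Nat.hyperfilter_le_atTop)
    (hlim (fun x => |φ x|) hφ.continuous.abs hφ.compact.abs) fun k => ?_
  rw [(hD k).integral_eq φ hφ.smooth hφ.compact hφ.subset, norm_neg]
  exact norm_integral_le_integral_abs_variation (D k) φ

/-! ### Lower semicontinuity of the weighted variation -/

section Weighted

variable {Ω : Set (E n)} {a : E n → ℝ}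

lemma isOpen_inter_lt (hΩ : IsOpen Ω) (ha : LowerSemicontinuousOn a Ω) (t : ℝ) :
    IsOpen ({x | t < a x} ∩ Ω) := by
  obtain ⟨u, hu, h⟩ := lowerSemicontinuousOn_iff_preimage_Ioi.1 ha t
  have : {x | t < a x} ∩ Ω = Ω ∩ u := by rw [← h, inter_comm]; rfl
  rw [this]
  exact hΩ.inter hu

/-- Only the values on `Ω` are controlled, so the representative is the extension by zero:
nonnegative, with superlevel set everything for `t < 0` and open for `t ≥ 0`. -/
lemma aemeasurable_of_lowerSemicontinuousOn (hΩ : IsOpen Ω) (ha : LowerSemicontinuousOn a Ω)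
    (ha0 : ∀ x ∈ Ω, 0 ≤ a x) (μ : Measure (E n)) : AEMeasurable a (μ.restrict Ω) := by
  refine ⟨Ω.indicator a, measurable_of_Ioi fun t => ?_,
    (indicator_ae_eq_restrict hΩ.measurableSet).symm⟩
  rcases lt_or_ge t 0 with ht | ht
  · convert MeasurableSet.univ
    exact eq_univ_of_forall fun x => ht.trans_le (indicator_nonneg ha0 x)
  · convert (isOpen_inter_lt hΩ ha t).measurableSet
    ext x
    by_cases hx : x ∈ Ω <;> simp [hx, ht]

/-- Lower semicontinuity of the weighted total variation. -/
lemma setLIntegral_variation_le_liminf (hΩ : IsOpen Ω) (ha : LowerSemicontinuousOn a Ω)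
    (ha0 : ∀ x ∈ Ω, 0 ≤ a x) (μ : VectorMeasure (E n) (E n))
    (μk : ℕ → VectorMeasure (E n) (E n))
    (h : ∀ φ : E n → ℝ, IsTest Ω φ →
      Tendsto (fun k => ∫ᵛ x, φ x ∂•(μk k)) atTop (𝓝 (∫ᵛ x, φ x ∂•μ))) :
    ∫⁻ x in Ω, ENNReal.ofReal (a x) ∂μ.variation ≤
      liminf (fun k => ∫⁻ x in Ω, ENNReal.ofReal (a x) ∂(μk k).variation) atTop := by
  -- The layer cake formula reduces the weight to its superlevel sets, open in `Ω` by
  -- semicontinuity. The unweighted statement holds for each `t`, and Fatou integrates over `t`.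
  have hlc : ∀ ν : Measure (E n), ∫⁻ x in Ω, ENNReal.ofReal (a x) ∂ν =
      ∫⁻ t in Ioi (0 : ℝ), ν ({x | t < a x} ∩ Ω) := fun ν => by
    rw [lintegral_eq_lintegral_meas_lt _ (ae_restrict_of_forall_mem hΩ.measurableSet ha0)
      (aemeasurable_of_lowerSemicontinuousOn hΩ ha ha0 ν)]
    simp only [Measure.restrict_apply' hΩ.measurableSet]
  simp only [hlc]
  have hm : ∀ k, Measurable fun t : ℝ => (μk k).variation ({x | t < a x} ∩ Ω) := fun k =>
    Antitone.measurable fun s t hst => measure_mono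
      (inter_subset_inter_left _ fun x (hx : t < a x) => hst.trans_lt hx)
  refine le_trans (lintegral_mono fun t => ?_) (lintegral_liminf_le hm)
  exact variation_le_liminf_of_tendsto μ μk (isOpen_inter_lt hΩ ha t)
    fun φ hφ => h φ (hφ.mono inter_subset_right)

end Weighted

/-! ### Gradient measures and representatives -/

/-- Uniqueness of the gradient measure is never needed: the estimates use only its pairings with
test functions and its concentration on `Ω`. -/
lemma isGradMeasure_gradMeasure {Ω : Set (E n)} {u : E n → ℝ} (hu : u ∈ BV Ω) :
    IsGradMeasure Ω u (gradMeasure Ω u) := by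
  rw [gradMeasure, dif_pos hu.2]
  exact hu.2.choose_spec

lemma IsGradMeasure.congr {Ω : Set (E n)} {u v : E n → ℝ} {D : VectorMeasure (E n) (E n)}
    (h : IsGradMeasure Ω u D) (huv : u =ᵐ[volume.restrict Ω] v) : IsGradMeasure Ω v D :=
  ⟨h.restrict_eq, fun φ h1 h2 h3 => by
    rw [← h.integral_eq φ h1 h2 h3]
    refine integral_congr_ae ?_
    filter_upwards [huv] with x hx
    rw [hx]⟩

lemma zero_mem_BVMeanZero (Ω : Set (E n)) : (0 : E n → ℝ) ∈ BVMeanZero Ω :=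
  ⟨⟨integrable_zero _ _ _, 0, by simp, fun φ _ _ _ => by simp⟩, by simp⟩

/-- Membership in `BV Ω` says nothing off `Ω`, whereas the translation arguments need functions that
are measurable and integrable on the whole space. -/
lemma exists_measurable_representative {Ω : Set (E n)} (hΩ : IsOpen Ω) {u : E n → ℝ}
    (hu : IntegrableOn u Ω) : ∃ v : E n → ℝ, Measurable v ∧ Integrable v ∧ (∀ x ∉ Ω, v x = 0) ∧
      u =ᵐ[volume.restrict Ω] v := by
  have h1 := hu.aestronglyMeasurable.ae_eq_mk
  have h2 : u =ᵐ[volume.restrict Ω] Ω.indicator (hu.aestronglyMeasurable.mk u) :=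
    h1.trans (indicator_ae_eq_restrict hΩ.measurableSet).symm
  refine ⟨_, hu.aestronglyMeasurable.stronglyMeasurable_mk.measurable.indicator hΩ.measurableSet,
    ?_, fun x hx => indicator_of_notMem hx _, h2⟩
  exact (integrable_indicator_iff hΩ.measurableSet).2 (hu.congr h1)

/-- Mass of the gradient measure in terms of the perturbed measure. -/
lemma variation_real_univ_le {Ω : Set (E n)} (hΩ : IsOpen Ω) {D : VectorMeasure (E n) (E n)}
    (hD : D.restrict Ω = D) {F : E n → E n} (hF : IntegrableOn F Ω) :
    D.variation.real univ ≤
      (D + (volume.restrict Ω).withDensityᵥ F).variation.real Ω + ∫ x in Ω, ‖F x‖ := by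
  set Fm := (volume.restrict Ω).withDensityᵥ F
  have h1 : D.variation univ = D.variation Ω := by
    conv_lhs => rw [← hD, VectorMeasure.variation_restrict hΩ.measurableSet]
    simp
  have h2 : D.variation Ω ≤ (D + Fm).variation Ω + Fm.variation Ω := by
    conv_lhs => rw [← add_sub_cancel_right D Fm]
    exact VectorMeasure.variation_sub_le Ω
  have h3 : Fm.variation.real Ω = ∫ x in Ω, ‖F x‖ := by
    rw [integral_norm_eq_lintegral_enorm hF.aestronglyMeasurable, Measure.real,
      Measure.variation_withDensityᵥ hF, withDensity_apply _ hΩ.measurableSet,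
      Measure.restrict_restrict hΩ.measurableSet, inter_self]
  rw [← h3, Measure.real, Measure.real, Measure.real, h1,
    ← ENNReal.toReal_add (measure_ne_top _ _) (measure_ne_top _ _)]
  exact ENNReal.toReal_mono (by finiteness) h2

/-! ### Coercivity and lower semicontinuity of the energy -/

section Energy

variable {Ω : Set (E n)} {a H : E n → ℝ} {a₀ h : ℝ} {F : E n → E n}

lemma integrableOn_weight (hΩ : IsOpen Ω) (ha₀ : 0 < a₀) (ha : ∀ x ∈ Ω, a₀ ≤ a x)
    (hab : BddAbove (a '' Ω)) (hlsc : LowerSemicontinuousOn a Ω) (ν : Measure (E n))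
    [IsFiniteMeasure ν] : IntegrableOn a Ω ν := by
  obtain ⟨B, hB⟩ := hab
  refine Integrable.of_bound (C := B) (aemeasurable_of_lowerSemicontinuousOn hΩ hlsc
    (fun x hx => ha₀.le.trans (ha x hx)) ν).aestronglyMeasurable
    (ae_restrict_of_forall_mem hΩ.measurableSet fun x hx => ?_)
  rw [Real.norm_of_nonneg (ha₀.le.trans (ha x hx))]
  exact hB (mem_image_of_mem a hx)

/-- Coercivity of the energy. -/
lemma le_energy {Cp : ℝ} (hΩ : IsBoundedLipschitzDomain Ω)
    (hCp : ∀ (u : E n → ℝ) (M : ℝ), Measurable u → Integrable u → (∀ x ∉ Ω, u x = 0) →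
      ∫ x, u x = 0 → VarLe Ω u M → ∫ x, ‖u x‖ ≤ Cp * M)
    (ha₀ : 0 < a₀) (ha : ∀ x ∈ Ω, a₀ ≤ a x) (hab : BddAbove (a '' Ω))
    (hlsc : LowerSemicontinuousOn a Ω) (hF : IntegrableOn F Ω) (hh : 0 ≤ h)
    (hHb : ∀ᵐ x ∂volume.restrict Ω, ‖H x‖ ≤ h) {u : E n → ℝ} (hu : u ∈ BVMeanZero Ω) :
    (a₀ - h * Cp) * (gradMeasure Ω u).variation.real univ - a₀ * ∫ x in Ω, ‖F x‖ ≤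
      energy Ω a F H u := by
  have hD := isGradMeasure_gradMeasure hu.1
  set D := gradMeasure Ω u
  have hΩm := hΩ.isOpen.measurableSet
  obtain ⟨v, hvm, hvi, hv0, huv⟩ := exists_measurable_representative hΩ.isOpen hu.1.1
  have hvmean : ∫ x, v x = 0 := by
    rw [← setIntegral_eq_integral_of_forall_compl_eq_zero hv0, ← integral_congr_ae huv, hu.2]
  have hpoinc : ∫ x in Ω, ‖u x‖ ≤ Cp * D.variation.real univ := by
    have huvn : ∫ x in Ω, ‖u x‖ = ∫ x in Ω, ‖v x‖ :=
      integral_congr_ae (Filter.EventuallyEq.fun_comp huv norm)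
    rw [huvn, setIntegral_eq_integral_of_forall_compl_eq_zero fun x hx => by
      rw [hv0 x hx, norm_zero]]
    exact hCp v _ hvm hvi hv0 hvmean (hD.congr huv).varLe
  have hHu : -(h * ∫ x in Ω, ‖u x‖) ≤ ∫ x in Ω, H x * u x := by
    rw [← integral_const_mul]
    have hb : ‖∫ x in Ω, H x * u x‖ ≤ ∫ x in Ω, h * ‖u x‖ := by
      refine norm_integral_le_of_norm_le (hu.1.1.norm.const_mul h) ?_
      filter_upwards [hHb] with x hx
      rw [norm_mul]
      exact mul_le_mul_of_nonneg_right hx (norm_nonneg _)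
    exact neg_le_of_abs_le hb
  set μ := (D + (volume.restrict Ω).withDensityᵥ F).variation
  have hJ : a₀ * μ.real Ω ≤ ∫ x in Ω, a x ∂μ := by
    calc a₀ * μ.real Ω = ∫ _ in Ω, a₀ ∂μ := by simp [mul_comm]
      _ ≤ ∫ x in Ω, a x ∂μ := setIntegral_mono_on (integrable_const _)
          (integrableOn_weight hΩ.isOpen ha₀ ha hab hlsc μ) hΩm ha
  have hvar := variation_real_univ_le hΩ.isOpen hD.restrict_eq hF
  have h1 := mul_le_mul_of_nonneg_left hvar ha₀.le
  have h2 := mul_le_mul_of_nonneg_left hpoinc hh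
  change _ ≤ (∫ x in Ω, a x ∂μ) + ∫ x in Ω, H x * u x
  nlinarith

/-- Lower semicontinuity of the energy along `L¹` convergent sequences. -/
lemma energy_le_of_tendsto (hΩ : IsOpen Ω)
    (ha₀ : 0 < a₀) (ha : ∀ x ∈ Ω, a₀ ≤ a x) (hab : BddAbove (a '' Ω))
    (hlsc : LowerSemicontinuousOn a Ω)
    (hHm : AEStronglyMeasurable H (volume.restrict Ω))
    (hHb : ∀ᵐ x ∂volume.restrict Ω, ‖H x‖ ≤ h) {u : ℕ → E n → ℝ} {v : E n → ℝ}
    (hu : ∀ k, u k ∈ BV Ω) (hv : v ∈ BV Ω)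
    (hlim : Tendsto (fun k => ∫⁻ x in Ω, ‖u k x - v x‖ₑ) atTop (𝓝 0)) {m : ℝ}
    (hm : Tendsto (fun k => energy Ω a F H (u k)) atTop (𝓝 m)) : energy Ω a F H v ≤ m := by
  set Fm := (volume.restrict Ω).withDensityᵥ F with hFm
  have hfin : IsFiniteMeasure Fm.variation := isFiniteMeasure_variation Fm
  let μ : (E n → ℝ) → VectorMeasure (E n) (E n) := fun w => gradMeasure Ω w + Fm
  let J : (E n → ℝ) → ℝ := fun w => ∫ x in Ω, a x ∂(μ w).variation
  have hH : Tendsto (fun k => ∫ x in Ω, H x * u k x) atTop (𝓝 (∫ x in Ω, H x * v x)) := by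
    simpa only [smul_eq_mul, mul_comm] using
      tendsto_integral_smul_of_tendsto_lintegral (fun k => (hu k).1) hv.1 hHm hHb hlim
  -- The term in `H` converges, so the weighted variations converge too and their liminf is a
  -- genuine limit.
  have hJlim : Tendsto (fun k => J (u k)) atTop (𝓝 (m - ∫ x in Ω, H x * v x)) :=
    (hm.sub hH).congr fun k => add_sub_cancel_right _ _
  have hJ : ∀ w, ENNReal.ofReal (J w) = ∫⁻ x in Ω, ENNReal.ofReal (a x) ∂(μ w).variation :=
    fun w => ofReal_integral_eq_lintegral_ofReal
      (integrableOn_weight hΩ ha₀ ha hab hlsc _)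
      (ae_restrict_of_forall_mem hΩ.measurableSet fun x hx => ha₀.le.trans (ha x hx))
  -- The pairing with a test function depends on `w` only through an integral continuous in `L¹`;
  -- the contribution of `F` is fixed.
  have hpair : ∀ w ∈ BV Ω, ∀ φ, IsTest Ω φ → ∫ᵛ x, φ x ∂•(μ w) =
      -(∫ x in Ω, w x • gradient φ x) + ∫ᵛ x, φ x ∂•Fm := fun w hw φ hφ => by
    rw [VectorMeasure.integral_add_vectorMeasure (hφ.integrable _) (hφ.integrable _),
      (isGradMeasure_gradMeasure hw).integral_eq φ hφ.smooth hφ.compact hφ.subset, neg_neg]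
  have hlow := setLIntegral_variation_le_liminf hΩ hlsc (fun x hx => ha₀.le.trans (ha x hx))
    (μ v) (fun k => μ (u k)) fun φ hφ => by
      obtain ⟨C, -, hC⟩ := hφ.exists_bound_gradient
      simp only [hpair _ hv φ hφ, hpair _ (hu _) φ hφ]
      exact (tendsto_integral_smul_of_tendsto_lintegral (fun k => (hu k).1) hv.1
        hφ.continuous_gradient.aestronglyMeasurable (ae_of_all _ hC) hlim).neg.add_const _
  simp only [← hJ] at hlow
  rw [(ENNReal.tendsto_ofReal hJlim).liminf_eq] at hlow
  have hnn : 0 ≤ m - ∫ x in Ω, H x * v x := ge_of_tendsto' hJlim fun k =>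
    setIntegral_nonneg hΩ.measurableSet fun x hx => ha₀.le.trans (ha x hx)
  have h1 : J v ≤ m - ∫ x in Ω, H x * v x := (ENNReal.ofReal_le_ofReal_iff hnn).1 hlow
  change J v + ∫ x in Ω, H x * v x ≤ m
  linarith

end Energy

/-! ### The direct method -/

/-- Existence of minimizers for the Neumann problem, by the direct method. -/
theorem exists_energy_minimizer {n : ℕ} {Ω : Set (E n)} (hΩ : IsBoundedLipschitzDomain Ω) :
    ∃ C : ℝ, 0 < C ∧
      ∀ (a : E n → ℝ) (a₀ : ℝ) (F : E n → E n) (H : E n → ℝ),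
        0 < a₀ → (∀ x ∈ Ω, a₀ ≤ a x) → BddAbove (a '' Ω) → LowerSemicontinuousOn a Ω →
        IntegrableOn F Ω →
        AEStronglyMeasurable H (volume.restrict Ω) →
        eLpNorm H ⊤ (volume.restrict Ω) < ENNReal.ofReal (C * a₀) →
        ∃ u ∈ BVMeanZero Ω, ∀ v ∈ BVMeanZero Ω, energy Ω a F H u ≤ energy Ω a F H v := by
  obtain ⟨Cp, hCp0, hCp⟩ := exists_poincare_const hΩ
  refine ⟨1 / Cp, by positivity, fun a a₀ F H ha₀ ha hab hlsc hF hHm hHn => ?_⟩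
  have hopen := hΩ.isOpen
  have hHt : eLpNorm H ⊤ (volume.restrict Ω) ≠ ⊤ := hHn.ne_top
  set h : ℝ := (eLpNorm H ⊤ (volume.restrict Ω)).toReal with hh
  have hh0 : 0 ≤ h := ENNReal.toReal_nonneg
  have hHb : ∀ᵐ x ∂volume.restrict Ω, ‖H x‖ ≤ h := by
    filter_upwards [ae_le_eLpNormEssSup (f := H) (μ := volume.restrict Ω)] with x hx
    rw [← eLpNorm_exponent_top, ← ofReal_norm] at hx
    exact (ENNReal.ofReal_le_iff_le_toReal hHt).1 hx
  have hgap : 0 < a₀ - h * Cp := by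
    have h1 : h < 1 / Cp * a₀ := (ENNReal.lt_ofReal_iff_toReal_lt hHt).1 hHn
    have h2 := mul_lt_mul_of_pos_right h1 hCp0
    rw [mul_assoc, mul_comm a₀, ← mul_assoc, one_div_mul_cancel hCp0.ne', one_mul] at h2
    linarith
  have hcoer := fun {u : E n → ℝ} (hu : u ∈ BVMeanZero Ω) =>
    le_energy hΩ hCp ha₀ ha hab hlsc hF hh0 hHb hu
  set f₀ : ℝ := ∫ x in Ω, ‖F x‖
  -- a minimizing sequence
  set S : Set ℝ := energy Ω a F H '' BVMeanZero Ω
  have hSb : BddBelow S := by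
    refine ⟨-(a₀ * f₀), ?_⟩
    rintro _ ⟨u, hu, rfl⟩
    have h1 : 0 ≤ (a₀ - h * Cp) * (gradMeasure Ω u).variation.real univ :=
      mul_nonneg hgap.le measureReal_nonneg
    linarith [hcoer hu]
  obtain ⟨e, he_anti, he_lim, heS⟩ :=
    exists_seq_tendsto_sInf (Set.Nonempty.image _ ⟨0, zero_mem_BVMeanZero Ω⟩ : S.Nonempty) hSb
  choose u hu hue using heS
  -- The energies `e k` decrease, so coercivity at level `e 0` bounds all gradient masses.
  set M : ℝ := (e 0 + a₀ * f₀) / (a₀ - h * Cp)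
  have hM : ∀ k, (gradMeasure Ω (u k)).variation.real univ ≤ M := fun k => by
    rw [le_div_iff₀ hgap, mul_comm]
    have h1 := hcoer (hu k)
    rw [hue k] at h1
    linarith [he_anti (Nat.zero_le k)]
  have hM0 : 0 ≤ M := measureReal_nonneg.trans (hM 0)
  have hD := fun k => isGradMeasure_gradMeasure (hu k).1
  choose v hvm hvi hv0 huv using fun k => exists_measurable_representative hopen (hu k).1.1
  have hvD : ∀ k, IsGradMeasure Ω (v k) (gradMeasure Ω (u k)) := fun k => (hD k).congr (huv k)
  have hvmean : ∀ k, ∫ x, v k x = 0 := fun k => by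
    rw [← setIntegral_eq_integral_of_forall_compl_eq_zero (hv0 k), ← integral_congr_ae (huv k),
      (hu k).2]
  have hvV : ∀ k, VarLe Ω (v k) M := fun k => (hvD k).varLe.mono (hM k)
  -- One constant must bound both the `L¹` norm, at most `Cp * M` by Poincaré, and the variation, at
  -- most `M`.
  obtain ⟨w, j, -, hwi, -, hj, hlim⟩ := exists_subseq_tendsto hΩ (M := Cp * M + M) (u := v)
    fun k => ⟨hvm k, hvi k,
      (hCp _ _ (hvm k) (hvi k) (hv0 k) (hvmean k) (hvV k)).trans (by linarith),
      (hvV k).mono (by linarith [mul_nonneg hCp0.le hM0])⟩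
  have hlim' : Tendsto (fun i => ∫⁻ x in Ω, ‖u (j i) x - w x‖ₑ) atTop (𝓝 0) := by
    refine hlim.congr fun i => lintegral_congr_ae ?_
    filter_upwards [huv (j i)] with x hx
    rw [hx]
  have hwBV : w ∈ BV Ω := ⟨hwi.integrableOn, exists_isGradMeasure_of_tendsto hopen
    (fun i => (hu (j i)).1.1) hwi.integrableOn (fun i => hD (j i)) (fun i => hM (j i)) hlim'⟩
  have hwmean : ∫ x in Ω, w x = 0 := by
    have h1 := tendsto_integral_smul_of_tendsto_lintegral (g := fun _ => (1 : ℝ)) (C := 1)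
      (fun i => (hu (j i)).1.1) hwi.integrableOn aestronglyMeasurable_const (by simp) hlim'
    simp only [smul_eq_mul, mul_one] at h1
    exact tendsto_nhds_unique h1 (tendsto_const_nhds.congr fun i => ((hu (j i)).2).symm)
  refine ⟨w, ⟨hwBV, hwmean⟩, fun v hv => ?_⟩
  refine (energy_le_of_tendsto hopen ha₀ ha hab hlsc hHm hHb (fun i => (hu (j i)).1) hwBV
    hlim' (m := sInf S) ?_).trans (csInf_le hSb (mem_image_of_mem _ hv))
  exact (he_lim.comp hj.tendsto_atTop).congr fun i => (hue (j i)).symm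

end PArea

end

theorem mainTheorem8 (n : ℕ) (Ω : Set (PArea.E n)) (hΩ : PArea.IsBoundedLipschitzDomain Ω) :
    ∃ C : ℝ, 0 < C ∧
      ∀ (a : PArea.E n → ℝ) (a₀ : ℝ) (F : PArea.E n → PArea.E n) (H : PArea.E n → ℝ),
        0 < a₀ → (∀ x ∈ Ω, a₀ ≤ a x) → BddAbove (a '' Ω) → LowerSemicontinuousOn a Ω →
        IntegrableOn F Ω →
        AEStronglyMeasurable H (volume.restrict Ω) →
        eLpNorm H ∞ (volume.restrict Ω) < ENNReal.ofReal (C * a₀) →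
        ∃ u ∈ PArea.BVMeanZero Ω, ∀ v ∈ PArea.BVMeanZero Ω,
          PArea.energy Ω a F H u ≤ PArea.energy Ω a F H v :=
  PArea.exists_energy_minimizer hΩ
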